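/- **Conventions.** All spaces are finite-dimensional complex super vector spaces, and all bilinear forms are consistent ($(V_{\bar 0},V_{\bar 1})=0$) and super-symmetric ($(x,y)=(-1)^{|x||y|}(y,x)$). For such a space $V$ with a form, $C(V)$ is the algebra generated by $V$ with the relations $xy+(-1)^{|x||y|}yx=2(x,y)$, and $\Lambda(V)$ is the algebra generated by $V$ with $x\wedge y+(-1)^{|x||y|}y\wedge x=0$, graded by degree and parity: $\Lambda(V)=\bigoplus\Lambda^n_a(V)$. For $x\in V$ let $\iota(x)$ be the derivation of degree $(-1,|x|)$ of $\Lambda(V)$ with $\iota(x)y=(x,y)$ for $y\in V$. Then $\gamma(x)=x\wedge\cdot+\iota(x)$ extends to a representation $\gamma$ of $C(V)$ on $\Lambda(V)$, and $\eta(u)=\gamma(u)1$ is a linear bijection $C(V)\to\Lambda(V)$, through which $\Lambda(V)$ also carries the Clifford product $uv$; put $[u,v]_C=uv-(-1)^{|u||v|}vu$. **Data.** Let $\mathfrak r$ be a quadratic Lie superalgebra, i.e. a Lie superalgebra with a non-degenerate form $(\cdot,\cdot)_{\mathfrak r}$ such that $([x,y],z)=(x,[y,z])$. Let $\mathfrak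 p$ be a super vector space with a non-degenerate form $(\cdot,\cdot)_{\mathfrak p}$, and let $\nu:\mathfrak r\to\mathfrak{osp}(\mathfrak p)$ be a representation. Let $\mathfrak g=\mathfrak r\oplus\mathfrak p$, with $(\cdot,\cdot)_{\mathfrak g}$ the orthogonal sum of the two forms. The pair $(\nu,(\cdot,\cdot)_{\mathfrak g})$ is of Lie super type if there is a bracket on $\mathfrak g$, called a bracket of Lie super type, such that (a) $\mathfrak g$ is a quadratic Lie superalgebra with respect to $(\cdot,\cdot)_{\mathfrak g}$, and (b) $\mathfrak r$, with its given bracket, is a subalgebra and $[x,y]=\nu(x)y$ for $x\in\mathfrak r$, $y\in\mathfrak p$. Let $\{x_i\}$ be a basis of $\mathfrak r$ and $\{x^i\}$ its dual basis, $(x^i,x_j)_{\mathfrak r}=\delta_{ij}$, and let $\mathrm{Cas}_{\mathfrak r}=\sum_i x_ix^i\in U(\mathfrak r)$. **Theorem.** There is a unique $\phi_{\mathfrak r}\in\Lambda^3_{\bar 0}(\mathfrak r)$ with $[x,y]=2\iota(x)\iota(y)\phi_{\mathfrak r}$ for all $x,y\in\mathfrak r$, and there is a unique even homomorphism of Lie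 superalgebras $\nu_*:\mathfrak r\to(\Lambda^2(\mathfrak p),[\cdot,\cdot]_C)$ with $[\nu_*(x),y]_C=\nu(x)y$ for all $x\in\mathfrak r$, $y\in\mathfrak p$. Extend $\nu_*$ to a homomorphism from $U(\mathfrak r)$ to the algebra $\Lambda(\mathfrak p)$ with the Clifford product, and put $$\phi_\nu=\sum_i\nu_*(x_i)\wedge x^i,$$ $$\mathcal V=\{\phi_{\mathfrak p}\in\Lambda^3_{\bar 0}(\mathfrak p)\;:\;[\nu_*(x),\phi_{\mathfrak p}]_C=0\ \text{for all }x\in\mathfrak r,\ \ \nu_*(\mathrm{Cas}_{\mathfrak r})+\phi_{\mathfrak p}^2\in\mathbb C\},$$ where $\phi_{\mathfrak p}^2$ is the Clifford square. For $\phi_{\mathfrak p}\in\mathcal V$ the element $\phi=\phi_{\mathfrak r}+\phi_\nu+\phi_{\mathfrak p}$ lies in $\Lambda^3_{\bar 0}(\mathfrak g)$, and the map which sends $\phi_{\mathfrak p}$ to the bracket $$[z_1,z_2]^{\phi_{\mathfrak p}}=2\iota(z_1)\iota(z_2)\phi\qquad(z_1,z_2\in\mathfrak g)$$ is a bijection from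 $\mathcal V$ onto the set of brackets of Lie super type on $\mathfrak g$. In particular, $(\nu,(\cdot,\cdot)_{\mathfrak g})$ is of Lie super type if and only if $\mathcal V$ is non-empty. -/

import Mathlib

namespace SuperKostant

/-- The sign `(-1)^{ab}` attached to two parities. -/
def sgn (a b : ZMod 2) : ℂ := (-1) ^ (a.val * b.val)

theorem sgn_zero_left (b : ZMod 2) : sgn 0 b = 1 := by simp [sgn]
theorem sgn_zero_right (b : ZMod 2) : sgn b 0 = 1 := by simp [sgn]
theorem sgn_one_one : sgn 1 1 = -1 := by simp [sgn, ZMod.val_one]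

theorem zmod2_cases (a : ZMod 2) : a = 0 ∨ a = 1 := by
  revert a; decide

/-- A complex super vector space: `V` with a splitting `V = V₀ ⊕ V₁`. -/
structure SuperSpace (V : Type*) [AddCommGroup V] [Module ℂ V] where
  part : ZMod 2 → Submodule ℂ V
  isCompl : IsCompl (part 0) (part 1)

section space
variable {V : Type*} [AddCommGroup V] [Module ℂ V] (S : SuperSpace V)

/-- The projection of a super vector space onto its part of parity `a`. -/
noncomputable def SuperSpace.pr (a : ZMod 2) : V →ₗ[ℂ] V :=
  if a = 0 then Submodule.projection _ _ S.isCompl else Submodule.projection _ _ S.isCompl.symm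

theorem SuperSpace.pr_same {a : ZMod 2} {x : V} (hx : x ∈ S.part a) : S.pr a x = x := by
  rcases zmod2_cases a with rfl | rfl
  · exact Submodule.projection_apply_of_mem_left S.isCompl hx
  · exact Submodule.projection_apply_of_mem_left S.isCompl.symm hx

theorem SuperSpace.pr_ne {a b : ZMod 2} {x : V} (hx : x ∈ S.part a) (h : b ≠ a) :
    S.pr b x = 0 := by
  rcases zmod2_cases a with rfl | rfl <;> rcases zmod2_cases b with rfl | rfl
  · exact absurd rfl h
  · exact (Submodule.projection_apply_eq_zero_iff S.isCompl.symm).2 hx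
  · exact (Submodule.projection_apply_eq_zero_iff S.isCompl).2 hx
  · exact absurd rfl h

theorem SuperSpace.exists_add (x : V) : ∃ y ∈ S.part 0, ∃ z ∈ S.part 1, x = y + z := by
  have h : x ∈ S.part 0 ⊔ S.part 1 := by rw [S.isCompl.sup_eq_top]; trivial
  obtain ⟨y, hy, z, hz, e⟩ := Submodule.mem_sup.1 h
  exact ⟨y, hy, z, hz, e.symm⟩

/-- The map `x ↦ (-1)^{b|x|} x`. -/
noncomputable def SuperSpace.twist (b : ZMod 2) : V →ₗ[ℂ] V :=
  S.pr 0 + sgn b 1 • S.pr 1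

theorem SuperSpace.twist_apply {a : ZMod 2} {x : V} (hx : x ∈ S.part a) (b : ZMod 2) :
    S.twist b x = sgn b a • x := by
  rcases zmod2_cases a with rfl | rfl
  · simp [SuperSpace.twist, S.pr_same hx, S.pr_ne hx, sgn_zero_right]
  · simp [SuperSpace.twist, S.pr_same hx, S.pr_ne hx]

/-- A consistent super-symmetric bilinear form on a super vector space. -/
structure SuperForm where
  form : LinearMap.BilinForm ℂ V
  consistent : ∀ (a b : ZMod 2) (x y : V), x ∈ S.part a → y ∈ S.part b → a ≠ b → form x y = 0
  supersymm : ∀ (a b : ZMod 2) (x y : V), x ∈ S.part a → y ∈ S.part b →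
    form x y = sgn a b * form y x

instance : Zero (SuperForm S) := ⟨⟨0, by simp, by simp⟩⟩

instance : Neg (SuperForm S) := ⟨fun B => ⟨-B.form,
  fun a b x y hx hy h => by simp [B.consistent a b x y hx hy h],
  fun a b x y hx hy => by simp [B.supersymm a b x y hx hy]⟩⟩

/-- The direct sum of two super vector spaces. -/
def SuperSpace.prod {W : Type*} [AddCommGroup W] [Module ℂ W] (T : SuperSpace W) :
    SuperSpace (V × W) where
  part a := (S.part a).prod (T.part a)
  isCompl := by
    constructor
    · rw [disjoint_iff, Submodule.prod_inf_prod, S.isCompl.inf_eq_bot, T.isCompl.inf_eq_bot,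
        Submodule.prod_bot]
    · rw [codisjoint_iff, Submodule.prod_sup_prod, S.isCompl.sup_eq_top, T.isCompl.sup_eq_top,
        Submodule.prod_top]

end space

section clifford
variable {V : Type*} [AddCommGroup V] [Module ℂ V] {S : SuperSpace V}

/-- The orthogonal direct sum of two forms. -/
def SuperForm.prod (B : SuperForm S) {W : Type*} [AddCommGroup W] [Module ℂ W]
    {T : SuperSpace W} (C : SuperForm T) : SuperForm (S.prod T) where
  form := B.form.compl₁₂ (LinearMap.fst ℂ V W) (LinearMap.fst ℂ V W) +
    C.form.compl₁₂ (LinearMap.snd ℂ V W) (LinearMap.snd ℂ V W)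
  consistent a b x y hx hy h := by
    simp [B.consistent a b x.1 y.1 hx.1 hy.1 h, C.consistent a b x.2 y.2 hx.2 hy.2 h]
  supersymm a b x y hx hy := by
    simp only [LinearMap.add_apply, LinearMap.compl₁₂_apply, LinearMap.fst_apply,
      LinearMap.snd_apply]
    rw [B.supersymm a b x.1 y.1 hx.1 hy.1, C.supersymm a b x.2 y.2 hx.2 hy.2]; ring

/-- The defining relations `xy + (-1)^{|x||y|} yx = 2 (x,y)`. -/
inductive CliffordRel (B : SuperForm S) : TensorAlgebra ℂ V → TensorAlgebra ℂ V → Prop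
  | of {a b : ZMod 2} {x y : V} (hx : x ∈ S.part a) (hy : y ∈ S.part b) :
    CliffordRel B
      (TensorAlgebra.ι ℂ x * TensorAlgebra.ι ℂ y
        + sgn a b • (TensorAlgebra.ι ℂ y * TensorAlgebra.ι ℂ x))
      (algebraMap ℂ _ (2 * B.form x y))

/-- The Clifford algebra `C(V)` of a super vector space with a form. -/
def SClifford (B : SuperForm S) : Type _ := RingQuot (CliffordRel B)

noncomputable instance (B : SuperForm S) : Ring (SClifford B) :=
  inferInstanceAs (Ring (RingQuot (CliffordRel B)))
noncomputable instance (B : SuperForm S) : Algebra ℂ (SClifford B) :=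
  inferInstanceAs (Algebra ℂ (RingQuot (CliffordRel B)))

/-- The canonical map `V → C(V)`. -/
noncomputable def zeta (B : SuperForm S) : V →ₗ[ℂ] SClifford B :=
  (RingQuot.mkAlgHom ℂ (CliffordRel B)).toLinearMap ∘ₗ TensorAlgebra.ι ℂ

theorem zeta_rel (B : SuperForm S) {a b : ZMod 2} {x y : V} (hx : x ∈ S.part a)
    (hy : y ∈ S.part b) :
    zeta B x * zeta B y + sgn a b • (zeta B y * zeta B x)
      = algebraMap ℂ (SClifford B) (2 * B.form x y) := by
  have h := RingQuot.mkAlgHom_rel ℂ (CliffordRel.of (B := B) hx hy)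
  rw [map_add, map_smul, map_mul, map_mul, AlgHom.commutes] at h
  exact h

/-- The universal property of `C(V)`. -/
noncomputable def SClifford.lift (B : SuperForm S) {A : Type*} [Semiring A] [Algebra ℂ A]
    (f : V →ₗ[ℂ] A)
    (hf : ∀ (a b : ZMod 2) (x y : V), x ∈ S.part a → y ∈ S.part b →
      f x * f y + sgn a b • (f y * f x) = algebraMap ℂ A (2 * B.form x y)) :
    SClifford B →ₐ[ℂ] A :=
  RingQuot.liftAlgHom ℂ ⟨TensorAlgebra.lift ℂ f, by
    rintro _ _ ⟨hx, hy⟩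
    rw [map_add, map_smul, map_mul, map_mul, TensorAlgebra.lift_ι_apply,
      TensorAlgebra.lift_ι_apply, AlgHom.commutes]
    exact hf _ _ _ _ hx hy⟩

theorem SClifford.lift_zeta (B : SuperForm S) {A : Type*} [Semiring A] [Algebra ℂ A]
    (f : V →ₗ[ℂ] A) (hf) (x : V) : SClifford.lift B f hf (zeta B x) = f x := by
  have h : SClifford.lift B f hf (zeta B x) = TensorAlgebra.lift ℂ f (TensorAlgebra.ι ℂ x) :=
    RingQuot.liftAlgHom_mkAlgHom_apply ℂ (TensorAlgebra.lift ℂ f) _ (TensorAlgebra.ι ℂ x)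
  rw [h, TensorAlgebra.lift_ι_apply]

theorem SClifford.induction {B : SuperForm S} (P : Submodule ℂ (SClifford B))
    (h1 : (1 : SClifford B) ∈ P)
    (hmul : ∀ (a : ZMod 2) (x : V) (u : SClifford B), x ∈ S.part a → u ∈ P → zeta B x * u ∈ P)
    (u : SClifford B) : u ∈ P := by
  have hmul' : ∀ (x : V) (u : SClifford B), u ∈ P → zeta B x * u ∈ P := by
    intro x u hu
    obtain ⟨y, hy, z, hz, rfl⟩ := S.exists_add x
    rw [map_add, add_mul]
    exact P.add_mem (hmul 0 y u hy hu) (hmul 1 z u hz hu)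
  obtain ⟨t, rfl⟩ := RingQuot.mkAlgHom_surjective ℂ (CliffordRel B) u
  have key : ∀ v ∈ P, (show SClifford B from RingQuot.mkAlgHom ℂ (CliffordRel B) t) * v ∈ P := by
    induction t using TensorAlgebra.induction with
    | algebraMap c =>
      intro v hv
      rw [AlgHom.commutes]
      have : (algebraMap ℂ (SClifford B) c) * v ∈ P := by
        rw [← Algebra.smul_def]; exact P.smul_mem c hv
      exact this
    | ι x => intro v hv; exact hmul' x v hv
    | mul s t hs ht =>
      intro v hv
      rw [map_mul]
      have := hs _ (ht v hv)
      rw [← mul_assoc] at this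
      exact this
    | add s t hs ht =>
      intro v hv
      rw [map_add]
      have := P.add_mem (hs v hv) (ht v hv)
      rw [← add_mul] at this
      exact this
  have := key 1 h1
  rwa [mul_one] at this

/-- For `y ∈ V`, the operator on pairs `(u, w)`, with `u` in the algebra and `w : V → algebra`
linear, given by `(u, w) ↦ (y u, x ↦ D(x,y) u - (-1)^{|x||y|} y w(x))`. -/
noncomputable def contrAux (B D : SuperForm S) :
    V →ₗ[ℂ] Module.End ℂ (SClifford B × (V →ₗ[ℂ] SClifford B)) :=
  LinearMap.mk₂ ℂ (fun y p => (zeta B y * p.1,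
    (D.form.flip y).smulRight p.1
      - LinearMap.mulLeft ℂ (zeta B (S.pr 0 y)) ∘ₗ p.2 ∘ₗ S.twist 0
      - LinearMap.mulLeft ℂ (zeta B (S.pr 1 y)) ∘ₗ p.2 ∘ₗ S.twist 1))
    (by
      intro y y' p
      refine Prod.ext (by simp [add_mul]) (LinearMap.ext fun x => ?_)
      simp [add_mul, add_smul]; abel)
    (by
      intro c y p
      refine Prod.ext (by simp) (LinearMap.ext fun x => ?_)
      simp [smul_sub, mul_smul])
    (by
      intro y p p'
      refine Prod.ext (by simp [mul_add]) (LinearMap.ext fun x => ?_)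
      simp [mul_add]; abel)
    (by
      intro c y p
      refine Prod.ext (by simp) (LinearMap.ext fun x => ?_)
      simp [smul_sub, smul_comm c])

theorem contrAux_fst (B D : SuperForm S) (y : V) (p) :
    (contrAux B D y p).1 = zeta B y * p.1 := rfl

theorem contrAux_snd (B D : SuperForm S) {a b : ZMod 2} {x y : V} (hx : x ∈ S.part a)
    (hy : y ∈ S.part b) (p) :
    (contrAux B D y p).2 x = D.form x y • p.1 - sgn a b • (zeta B y * p.2 x) := by
  have h0 : (contrAux B D y p).2 x = D.form x y • p.1
      - zeta B (S.pr 0 y) * p.2 (S.twist 0 x) - zeta B (S.pr 1 y) * p.2 (S.twist 1 x) := rfl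
  rw [h0, S.twist_apply hx, S.twist_apply hx]
  rcases zmod2_cases b with rfl | rfl
  · simp [S.pr_same hy, S.pr_ne hy, sgn_zero_left, sgn_zero_right]
  · rcases zmod2_cases a with rfl | rfl
    · simp [S.pr_same hy, S.pr_ne hy, sgn_zero_left, sgn_zero_right]
    · simp [S.pr_same hy, S.pr_ne hy, sgn_one_one]

theorem super_ext {W : Type*} [AddCommGroup W] [Module ℂ W] {f g : V →ₗ[ℂ] W} (S : SuperSpace V)
    (h : ∀ (a : ZMod 2) (x : V), x ∈ S.part a → f x = g x) : f = g := by
  ext x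
  obtain ⟨y, hy, z, hz, rfl⟩ := S.exists_add x
  rw [map_add, map_add, h 0 y hy, h 1 z hz]

theorem contrAux_rel (B D : SuperForm S) (a b : ZMod 2) (x y : V) (hx : x ∈ S.part a)
    (hy : y ∈ S.part b) :
    contrAux B D x * contrAux B D y + sgn a b • (contrAux B D y * contrAux B D x)
      = algebraMap ℂ _ (2 * B.form x y) := by
  refine LinearMap.ext fun p => Prod.ext ?_ (super_ext S fun c z hz => ?_)
  · have h := congrArg (· * p.1) (zeta_rel B hx hy)
    simp only [add_mul, smul_mul_assoc, mul_assoc, ← Algebra.smul_def] at h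
    exact h
  · have h := congrArg (· * p.2 z) (zeta_rel B hx hy)
    simp only [add_mul, smul_mul_assoc, mul_assoc, ← Algebra.smul_def] at h
    have e1 : (contrAux B D x (contrAux B D y p)).2 z = D.form z x • (zeta B y * p.1)
        - sgn c a • (zeta B x * (D.form z y • p.1 - sgn c b • (zeta B y * p.2 z))) := by
      rw [contrAux_snd B D hz hx, contrAux_snd B D hz hy, contrAux_fst]
    have e2 : (contrAux B D y (contrAux B D x p)).2 z = D.form z y • (zeta B x * p.1)
        - sgn c b • (zeta B y * (D.form z x • p.1 - sgn c a • (zeta B x * p.2 z))) := by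
      rw [contrAux_snd B D hz hy, contrAux_snd B D hz hx, contrAux_fst]
    have goal' : (contrAux B D x (contrAux B D y p)).2 z
        + sgn a b • (contrAux B D y (contrAux B D x p)).2 z = (2 * B.form x y) • p.2 z := by
      rw [e1, e2, ← h]
      simp only [mul_sub, mul_smul_comm]
      have hc1 : c ≠ a → D.form z x = 0 := D.consistent c a z x hz hx
      have hc2 : c ≠ b → D.form z y = 0 := D.consistent c b z y hz hy
      have hc3 : a ≠ b → B.form x y = 0 := B.consistent a b x y hx hy
      rcases zmod2_cases a with rfl | rfl <;> rcases zmod2_cases b with rfl | rfl <;>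
        rcases zmod2_cases c with rfl | rfl <;>
        simp only [sgn_zero_left, sgn_zero_right, sgn_one_one] at h ⊢ <;>
        (try simp at hc1) <;> (try simp at hc2) <;> (try simp at hc3) <;>
        (try simp only [hc1]) <;> (try simp only [hc2]) <;>
        first
        | module
        | (rw [hc3] at h
           linear_combination (norm := module) (-2 : ℂ) • h)
    exact goal'

/-- The extension of `contrAux` to the Clifford algebra. -/
noncomputable def contrHom (B D : SuperForm S) :
    SClifford B →ₐ[ℂ] Module.End ℂ (SClifford B × (V →ₗ[ℂ] SClifford B)) :=
  SClifford.lift B (contrAux B D) (contrAux_rel B D)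

/-- The contraction `ι(x)` for the form `D` on the Clifford algebra of the form `B`: the
derivation of degree `(-1, |x|)` with `ι(x) y = D(x,y)` for `y ∈ V`
(see `contr_one` and `contr_zeta_mul`). -/
noncomputable def contr (B D : SuperForm S) : V →ₗ[ℂ] SClifford B →ₗ[ℂ] SClifford B :=
  (LinearMap.snd ℂ (SClifford B) (V →ₗ[ℂ] SClifford B) ∘ₗ
    LinearMap.applyₗ ((1 : SClifford B), (0 : V →ₗ[ℂ] SClifford B)) ∘ₗ
    (contrHom B D).toLinearMap).flip

theorem contr_one (B D : SuperForm S) (x : V) : contr B D x 1 = 0 := by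
  simp [contr]

theorem contrHom_fst (B D : SuperForm S) (u : SClifford B) :
    (contrHom B D u (1, 0)).1 = u := by
  refine SClifford.induction (LinearMap.eqLocus
    (LinearMap.fst ℂ (SClifford B) (V →ₗ[ℂ] SClifford B) ∘ₗ
    LinearMap.applyₗ ((1 : SClifford B), (0 : V →ₗ[ℂ] SClifford B)) ∘ₗ
    (contrHom B D).toLinearMap) LinearMap.id) ?_ ?_ u
  · simp
  · intro a x u _ hu
    simp only [LinearMap.mem_eqLocus, LinearMap.comp_apply, AlgHom.toLinearMap_apply,
      LinearMap.applyₗ_apply_apply, LinearMap.fst_apply, LinearMap.id_apply, map_mul,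
      Module.End.mul_apply, contrHom, SClifford.lift_zeta, contrAux_fst] at hu ⊢
    rw [hu]

theorem contr_zeta_mul (B D : SuperForm S) {a b : ZMod 2} {x y : V} (hx : x ∈ S.part a)
    (hy : y ∈ S.part b) (u : SClifford B) :
    contr B D x (zeta B y * u) = D.form x y • u - sgn a b • (zeta B y * contr B D x u) := by
  have h : ∀ v, contr B D x v
      = (contrHom B D v (1, 0)).2 x := fun _ => rfl
  rw [h, h, map_mul, Module.End.mul_apply, contrHom, SClifford.lift_zeta, ← contrHom, contrAux_snd B D hx hy,
    contrHom_fst]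

theorem contr_zeta (B D : SuperForm S) {a b : ZMod 2} {x y : V} (hx : x ∈ S.part a)
    (hy : y ∈ S.part b) : contr B D x (zeta B y) = D.form x y • 1 := by
  have h := contr_zeta_mul B D hx hy 1
  simpa [contr_one] using h

theorem contr_contr (B D D' : SuperForm S) {a b : ZMod 2} {x y : V} (hx : x ∈ S.part a)
    (hy : y ∈ S.part b) (u : SClifford B) :
    contr B D x (contr B D' y u) + sgn a b • contr B D' y (contr B D x u) = 0 := by
  refine SClifford.induction (LinearMap.ker
    (contr B D x ∘ₗ contr B D' y + sgn a b • (contr B D' y ∘ₗ contr B D x))) ?_ ?_ u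
  · simp [contr_one]
  · intro c z u hz hu
    simp only [LinearMap.mem_ker, LinearMap.add_apply, LinearMap.comp_apply,
      LinearMap.smul_apply] at hu ⊢
    rw [contr_zeta_mul B D' hy hz, contr_zeta_mul B D hx hz, map_sub, map_sub, map_smul, map_smul,
      map_smul, map_smul, contr_zeta_mul B D' hy hz, contr_zeta_mul B D hx hz]
    have h := congrArg (zeta B z * ·) hu
    simp only [mul_add, mul_smul_comm, mul_zero] at h
    have hc1 : a ≠ c → D.form x z = 0 := D.consistent a c x z hx hz
    have hc2 : b ≠ c → D'.form y z = 0 := D'.consistent b c y z hy hz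
    rcases zmod2_cases a with rfl | rfl <;> rcases zmod2_cases b with rfl | rfl <;>
      rcases zmod2_cases c with rfl | rfl <;>
      simp only [sgn_zero_left, sgn_zero_right, sgn_one_one] at h ⊢ <;>
      (try simp at hc1) <;> (try simp at hc2) <;> (try simp only [hc1]) <;>
      (try simp only [hc2]) <;>
      first
      | linear_combination (norm := module) h
      | linear_combination (norm := module) (-1 : ℂ) • h

/-- When `B' = B + D`, the action of `C(V, B')` on `C(V, B)` in which `x ∈ V` acts as the left
multiplication by `x` plus the contraction `ι(x)` for `D`. -/
noncomputable def cliffordAction (B' B D : SuperForm S)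
    (h : ∀ x y, B'.form x y = B.form x y + D.form x y) :
    SClifford B' →ₐ[ℂ] Module.End ℂ (SClifford B) :=
  SClifford.lift B' ((Algebra.lmul ℂ (SClifford B)).toLinearMap ∘ₗ zeta B + contr B D) (by
    intro a b x y hx hy
    refine LinearMap.ext fun u => ?_
    have h1 := congrArg (· * u) (zeta_rel B hx hy)
    simp only [add_mul, smul_mul_assoc, mul_assoc, ← Algebra.smul_def] at h1
    have h2 := contr_contr B D D hx hy u
    have h3 := contr_zeta_mul B D hx hy u
    have h4 := contr_zeta_mul B D hy hx u
    have h5 := D.supersymm a b x y hx hy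
    have goal' : zeta B x * (zeta B y * u + contr B D y u)
        + contr B D x (zeta B y * u + contr B D y u)
        + sgn a b • (zeta B y * (zeta B x * u + contr B D x u)
        + contr B D y (zeta B x * u + contr B D x u)) = (2 * B'.form x y) • u := by
      rw [map_add, map_add, h3, h4, h]
      simp only [mul_add]
      rcases zmod2_cases a with rfl | rfl <;> rcases zmod2_cases b with rfl | rfl <;>
        simp only [sgn_zero_left, sgn_zero_right, sgn_one_one] at h1 h2 h5 ⊢ <;>
        rw [h5] <;> linear_combination (norm := module) h1 + h2
    exact goal')

/-- The linear map `u ↦ γ(u) 1`, with `γ` the action `cliffordAction`. -/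
noncomputable def changeForm (B' B D : SuperForm S)
    (h : ∀ x y, B'.form x y = B.form x y + D.form x y) : SClifford B' →ₗ[ℂ] SClifford B :=
  LinearMap.applyₗ (1 : SClifford B) ∘ₗ (cliffordAction B' B D h).toLinearMap

theorem changeForm_one (B' B D : SuperForm S) (h) : changeForm B' B D h 1 = 1 := by
  simp [changeForm]

theorem changeForm_zeta_mul (B' B D : SuperForm S) (h) (x : V) (u : SClifford B') :
    changeForm B' B D h (zeta B' x * u)
      = zeta B x * changeForm B' B D h u + contr B D x (changeForm B' B D h u) := by
  simp [changeForm, cliffordAction, SClifford.lift_zeta]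

theorem changeForm_contr (B' B D E : SuperForm S) (h) {a : ZMod 2} {x : V} (hx : x ∈ S.part a)
    (u : SClifford B') :
    changeForm B' B D h (contr B' E x u) = contr B E x (changeForm B' B D h u) := by
  refine SClifford.induction (LinearMap.eqLocus
    (changeForm B' B D h ∘ₗ contr B' E x) (contr B E x ∘ₗ changeForm B' B D h)) ?_ ?_ u
  · simp [changeForm_one, contr_one]
  · intro b y u hy hu
    simp only [LinearMap.mem_eqLocus, LinearMap.comp_apply] at hu ⊢
    have h2 := contr_contr B E D hx hy (changeForm B' B D h u)
    rw [contr_zeta_mul B' E hx hy, map_sub, map_smul, map_smul, changeForm_zeta_mul, hu,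
      changeForm_zeta_mul, map_add, contr_zeta_mul B E hx hy, eq_neg_of_add_eq_zero_left h2]
    module

theorem contr_neg (B D : SuperForm S) {a : ZMod 2} {x : V} (hx : x ∈ S.part a)
    (u : SClifford B) : contr B (-D) x u = - contr B D x u := by
  refine SClifford.induction (LinearMap.eqLocus (contr B (-D) x) (-contr B D x)) ?_ ?_ u
  · simp [contr_one]
  · intro b y u hy hu
    simp only [LinearMap.mem_eqLocus, LinearMap.neg_apply] at hu ⊢
    have e : (-D).form x y = - D.form x y := rfl
    rw [contr_zeta_mul _ _ hx hy, contr_zeta_mul _ _ hx hy, hu, e]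
    simp only [mul_neg]
    module

theorem neg_neg_form (D : SuperForm S) : - - D = D := by
  cases D
  simp only [Neg.neg, SuperForm.mk.injEq]
  exact neg_neg _

theorem changeForm_changeForm (B' B D : SuperForm S) (h h') (u : SClifford B') :
    changeForm B B' (-D) h' (changeForm B' B D h u) = u := by
  refine SClifford.induction (LinearMap.eqLocus
    (changeForm B B' (-D) h' ∘ₗ changeForm B' B D h) LinearMap.id) ?_ ?_ u
  · simp [changeForm_one]
  · intro b y u hy hu
    simp only [LinearMap.mem_eqLocus, LinearMap.comp_apply, LinearMap.id_apply] at hu ⊢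
    rw [changeForm_zeta_mul, map_add, changeForm_zeta_mul, changeForm_contr _ _ _ _ _ hy,
      contr_neg _ _ hy, hu]
    abel

/-- The exterior algebra `Λ(V)`: the algebra generated by `V` with the relations
`x ∧ y + (-1)^{|x||y|} y ∧ x = 0`. Its ring multiplication is the exterior multiplication. -/
abbrev SExterior (S : SuperSpace V) : Type _ := SClifford (0 : SuperForm S)

/-- `Λ(V)` is defined by the relations `x ∧ y + (-1)^{|x||y|} y ∧ x = 0`. -/
theorem exterior_rel {a b : ZMod 2} {x y : V} (hx : x ∈ S.part a) (hy : y ∈ S.part b) :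
    zeta (0 : SuperForm S) x * zeta 0 y + sgn a b • (zeta 0 y * zeta 0 x) = 0 := by
  have e : (0 : SuperForm S).form x y = 0 := rfl
  rw [zeta_rel 0 hx hy, e]
  simp

theorem form_add_neg (B : SuperForm S) (x y : V) :
    (0 : SuperForm S).form x y = B.form x y + (-B).form x y :=
  (add_neg_cancel (B.form x y)).symm

theorem form_zero_add (B : SuperForm S) (x y : V) :
    B.form x y = (0 : SuperForm S).form x y + B.form x y :=
  (zero_add (B.form x y)).symm

/-- The bijection `η : C(V) → Λ(V)`, `η(u) = γ(u) 1`, where `γ(x) = ε(x) + ι(x)` for `x ∈ V`. -/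
noncomputable def eta (B : SuperForm S) : SClifford B ≃ₗ[ℂ] SExterior S :=
  LinearEquiv.ofLinearMap (changeForm B 0 B (form_zero_add B)) (changeForm 0 B (-B) (form_add_neg B))
    (LinearMap.ext fun u => by
      have := changeForm_changeForm 0 B (-B) (form_add_neg B)
        (by rw [neg_neg_form]; exact form_zero_add B) u
      simp only [neg_neg_form] at this
      exact this)
    (LinearMap.ext fun u => changeForm_changeForm B 0 B (form_zero_add B) (form_add_neg B) u)

/-- The Clifford multiplication on `Λ(V)`, transported by `η`. -/
noncomputable def cmul (B : SuperForm S) (u v : SExterior S) : SExterior S :=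
  eta B ((eta B).symm u * (eta B).symm v)

/-- `[u,v]_C = uv - (-1)^{ab} vu` for `u` of parity `a` and `v` of parity `b`
(Clifford products). -/
noncomputable def ccomm (B : SuperForm S) (a b : ZMod 2) (u v : SExterior S) : SExterior S :=
  cmul B u v - sgn a b • cmul B v u

/-- The subspace `Λ^n_a(V)` spanned by the products `x₁ ∧ ⋯ ∧ x_n` of homogeneous vectors with
`|x₁| + ⋯ + |x_n| = a`. -/
noncomputable def extPart (S : SuperSpace V) (n : ℕ) (a : ZMod 2) :
    Submodule ℂ (SExterior S) :=
  Submodule.span ℂ {u | ∃ (d : Fin n → ZMod 2) (x : Fin n → V), (∀ i, x i ∈ S.part (d i)) ∧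
    ∑ i, d i = a ∧ u = (List.ofFn fun i => zeta 0 (x i)).prod}

/-- The contraction `ι(x)` on `Λ(V)` with respect to the form `B`. -/
noncomputable def iotaExt (B : SuperForm S) : V →ₗ[ℂ] SExterior S →ₗ[ℂ] SExterior S :=
  contr 0 B

/-- The projection `Λ(V) → Λ¹(V) = V`. -/
noncomputable def extToV (S : SuperSpace V) : SExterior S →ₗ[ℂ] V :=
  (TrivSqZeroExt.sndHom ℂ V) ∘ₗ
    letI : Module ℂᵐᵒᵖ V := Module.compHom V ((RingHom.id ℂ).fromOpposite mul_comm)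
    haveI : IsCentralScalar ℂ V := ⟨fun _ _ => rfl⟩
    (SClifford.lift (0 : SuperForm S) (TrivSqZeroExt.inrHom ℂ V) (by
      intro a b x y _ _
      have : (0 : SuperForm S).form x y = 0 := rfl
      simp [this])).toLinearMap

theorem extToV_zeta (x : V) : extToV S (zeta 0 x) = x := by
  simp [extToV, SClifford.lift_zeta]

/-- The bracket `[z₁,z₂]^φ = 2 ι(z₁) ι(z₂) φ`, an element of `Λ¹(V) = V` for `φ ∈ Λ³(V)`
(see `zeta_cubicBracket`). -/
noncomputable def cubicBracket (B : SuperForm S) (φ : SExterior S) : V →ₗ[ℂ] V →ₗ[ℂ] V :=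
  LinearMap.mk₂ ℂ (fun z₁ z₂ => (2 : ℂ) • extToV S (iotaExt B z₁ (iotaExt B z₂ φ)))
    (by intros; simp) (by intro c x y; simp [smul_comm c]) (by intros; simp)
    (by intro c x y; simp [smul_comm c])

theorem zeta_cubicBracket (B : SuperForm S) {a : ZMod 2} {φ : SExterior S}
    (hφ : φ ∈ extPart S 3 a) (z₁ z₂ : V) :
    zeta 0 (cubicBracket B φ z₁ z₂) = (2 : ℂ) • iotaExt B z₁ (iotaExt B z₂ φ) := by
  have key : ∀ u : SExterior S, zeta 0 (extToV S u) = u →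
      zeta 0 ((2 : ℂ) • extToV S u) = (2 : ℂ) • u := by
    intro u hu; rw [map_smul, hu]
  refine key _ ?_
  have hz : ∀ x : V, zeta (0 : SuperForm S) (extToV S (zeta 0 x)) = zeta 0 x := fun x => by
    rw [extToV_zeta]
  induction hφ using Submodule.span_induction with
  | zero => simp
  | add u v _ _ hu hv => simp only [map_add, hu, hv]
  | smul c u _ hu => simp only [map_smul, hu]
  | mem u hu =>
    obtain ⟨d, x, hx, -, rfl⟩ := hu
    have hl : (List.ofFn fun i => zeta (0 : SuperForm S) (x i)).prod
        = zeta 0 (x 0) * (zeta 0 (x 1) * zeta 0 (x 2)) := by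
      simp [List.ofFn_succ]
    rw [hl]
    generalize hU : zeta (0 : SuperForm S) (x 0) * (zeta 0 (x 1) * zeta 0 (x 2)) = U
    have hlin : ∀ (f g : V →ₗ[ℂ] SExterior S) (z : V),
        (∀ (b : ZMod 2) (z : V), z ∈ S.part b → f z = g z) → f z = g z := fun f g z h => by
      rw [super_ext S h]
    refine hlin (zeta 0 ∘ₗ extToV S ∘ₗ (iotaExt B).flip (iotaExt B z₂ U))
      ((iotaExt B).flip (iotaExt B z₂ U)) z₁ ?_
    intro b₁ w₁ h₁
    refine hlin (zeta 0 ∘ₗ extToV S ∘ₗ iotaExt B w₁ ∘ₗ (iotaExt B).flip U)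
      (iotaExt B w₁ ∘ₗ (iotaExt B).flip U) z₂ ?_
    intro b₂ w₂ h₂
    rw [← hU]
    simp only [LinearMap.comp_apply, LinearMap.flip_apply, iotaExt]
    simp only [contr_zeta_mul 0 B h₂ (hx 0), contr_zeta_mul 0 B h₂ (hx 1),
      contr_zeta 0 B h₂ (hx 2), mul_sub, map_sub,
      map_smul, mul_smul_comm, contr_zeta_mul 0 B h₁ (hx 0), contr_zeta_mul 0 B h₁ (hx 1),
      contr_zeta 0 B h₁ (hx 1), contr_zeta 0 B h₁ (hx 2), mul_one, hz]

/-- The algebra map `Λ(V) → Λ(W)` induced by an even linear map `f : V → W`. -/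
noncomputable def extMap {W : Type*} [AddCommGroup W] [Module ℂ W] (S : SuperSpace V)
    (T : SuperSpace W) (f : V →ₗ[ℂ] W) (hf : ∀ a x, x ∈ S.part a → f x ∈ T.part a) :
    SExterior S →ₐ[ℂ] SExterior T :=
  SClifford.lift 0 (zeta 0 ∘ₗ f) (fun a b x y hx hy => zeta_rel 0 (hf a x hx) (hf b y hy))

end clifford

section lie
variable {V : Type*} [AddCommGroup V] [Module ℂ V]

/-- A bracket that makes the super vector space `V` a Lie superalgebra. -/
structure IsLieSuper (S : SuperSpace V) (br : V →ₗ[ℂ] V →ₗ[ℂ] V) : Prop where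
  even : ∀ (a b : ZMod 2) (x y : V), x ∈ S.part a → y ∈ S.part b → br x y ∈ S.part (a + b)
  skew : ∀ (a b : ZMod 2) (x y : V), x ∈ S.part a → y ∈ S.part b →
    br x y = -(sgn a b • br y x)
  jacobi : ∀ (a b : ZMod 2) (x y z : V), x ∈ S.part a → y ∈ S.part b →
    br x (br y z) = br (br x y) z + sgn a b • br y (br x z)

/-- A bracket that makes `V` a quadratic Lie superalgebra with respect to the form `B`. -/
structure IsQuadraticLieSuper {S : SuperSpace V} (B : SuperForm S) (br : V →ₗ[ℂ] V →ₗ[ℂ] V) :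
    Prop extends IsLieSuper S br where
  nondegenerate : B.form.Nondegenerate
  invariant : ∀ x y z : V, B.form (br x y) z = B.form x (br y z)

/-- The defining relations of the enveloping algebra. -/
inductive EnvRel (S : SuperSpace V) (br : V →ₗ[ℂ] V →ₗ[ℂ] V) :
    TensorAlgebra ℂ V → TensorAlgebra ℂ V → Prop
  | of {a b : ZMod 2} {x y : V} (hx : x ∈ S.part a) (hy : y ∈ S.part b) :
    EnvRel S br
      (TensorAlgebra.ι ℂ x * TensorAlgebra.ι ℂ y
        - sgn a b • (TensorAlgebra.ι ℂ y * TensorAlgebra.ι ℂ x))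
      (TensorAlgebra.ι ℂ (br x y))

/-- The enveloping algebra `U` of the Lie superalgebra `V`. -/
def SEnv (S : SuperSpace V) (br : V →ₗ[ℂ] V →ₗ[ℂ] V) : Type _ := RingQuot (EnvRel S br)

noncomputable instance (S : SuperSpace V) (br : V →ₗ[ℂ] V →ₗ[ℂ] V) : Ring (SEnv S br) :=
  inferInstanceAs (Ring (RingQuot (EnvRel S br)))
noncomputable instance (S : SuperSpace V) (br : V →ₗ[ℂ] V →ₗ[ℂ] V) : Algebra ℂ (SEnv S br) :=
  inferInstanceAs (Algebra ℂ (RingQuot (EnvRel S br)))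

/-- The canonical map of the Lie superalgebra into its enveloping algebra. -/
noncomputable def envMap (S : SuperSpace V) (br : V →ₗ[ℂ] V →ₗ[ℂ] V) : V →ₗ[ℂ] SEnv S br :=
  (RingQuot.mkAlgHom ℂ (EnvRel S br)).toLinearMap ∘ₗ TensorAlgebra.ι ℂ

/-- The Casimir element `∑ xᵢ xⁱ` for a basis `x` and its dual basis `x'`. -/
noncomputable def casimir (S : SuperSpace V) (br : V →ₗ[ℂ] V →ₗ[ℂ] V) {ι : Type*} [Fintype ι]
    (x x' : ι → V) : SEnv S br :=
  ∑ i, envMap S br (x i) * envMap S br (x' i)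

/-- `φ ∈ Λ³(V)` is even and corresponds to the bracket: `[x,y] = 2 ι(x) ι(y) φ`. -/
def IsCubicElement {S : SuperSpace V} (B : SuperForm S) (br : V →ₗ[ℂ] V →ₗ[ℂ] V)
    (φ : SExterior S) : Prop :=
  φ ∈ extPart S 3 0 ∧ ∀ x y : V, zeta 0 (br x y) = (2 : ℂ) • iotaExt B x (iotaExt B y φ)

end lie

section kostant
variable {r p : Type*} [AddCommGroup r] [Module ℂ r] [AddCommGroup p] [Module ℂ p]
  {R : SuperSpace r} {P : SuperSpace p}

/-- A representation of the Lie superalgebra `r` on `p` with values in `osp(p)`. -/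
structure IsOspRep (R : SuperSpace r) (br : r →ₗ[ℂ] r →ₗ[ℂ] r) (Bp : SuperForm P)
    (ν : r →ₗ[ℂ] Module.End ℂ p) : Prop where
  even : ∀ (a b : ZMod 2) (x : r) (y : p), x ∈ R.part a → y ∈ P.part b → ν x y ∈ P.part (a + b)
  map_bracket : ∀ (a b : ZMod 2) (x x' : r), x ∈ R.part a → x' ∈ R.part b →
    ν (br x x') = ν x * ν x' - sgn a b • (ν x' * ν x)
  osp : ∀ (a b : ZMod 2) (x : r) (y z : p), x ∈ R.part a → y ∈ P.part b →
    Bp.form (ν x y) z + sgn a b * Bp.form y (ν x z) = 0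

/-- The homomorphism of Lie superalgebras `ν_* : r → Λ²(p)` (with the Clifford commutator on
`Λ²(p)`) induced by `ν`: it satisfies `[ν_*(x), y]_C = ν(x) y` for `x ∈ r`, `y ∈ p`. -/
structure IsNuStar (R : SuperSpace r) (br : r →ₗ[ℂ] r →ₗ[ℂ] r) (Bp : SuperForm P)
    (ν : r →ₗ[ℂ] Module.End ℂ p) (νs : r →ₗ[ℂ] SExterior P) : Prop where
  mem : ∀ (a : ZMod 2) (x : r), x ∈ R.part a → νs x ∈ extPart P 2 a
  map_bracket : ∀ (a b : ZMod 2) (x x' : r), x ∈ R.part a → x' ∈ R.part b →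
    νs (br x x') = ccomm Bp a b (νs x) (νs x')
  ccomm_eq : ∀ (a b : ZMod 2) (x : r) (y : p), x ∈ R.part a → y ∈ P.part b →
    ccomm Bp a b (νs x) (zeta 0 y) = zeta 0 (ν x y)

/-- The extension of `ν_*` to a homomorphism from the enveloping algebra of `r` to the Clifford
algebra of `p`. -/
noncomputable def nuStarEnv {br : r →ₗ[ℂ] r →ₗ[ℂ] r} {Bp : SuperForm P}
    {ν : r →ₗ[ℂ] Module.End ℂ p} {νs : r →ₗ[ℂ] SExterior P} (h : IsNuStar R br Bp ν νs) :
    SEnv R br →ₐ[ℂ] SClifford Bp :=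
  RingQuot.liftAlgHom ℂ ⟨TensorAlgebra.lift ℂ ((eta Bp).symm.toLinearMap ∘ₗ νs), by
    rintro _ _ ⟨hx, hy⟩
    rw [map_sub, map_smul, map_mul, map_mul, TensorAlgebra.lift_ι_apply,
      TensorAlgebra.lift_ι_apply, TensorAlgebra.lift_ι_apply]
    have := h.map_bracket _ _ _ _ hx hy
    simp [this, ccomm, cmul]⟩

/-- The condition on a bracket on `g = r ⊕ p` in the definition of Lie super type: `g` is a
quadratic Lie superalgebra with respect to the orthogonal sum of the two forms, `r` is a
subalgebra, and `[x,y] = ν(x) y` for `x ∈ r`, `y ∈ p`. -/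
structure IsLieSuperTypeBracket (br : r →ₗ[ℂ] r →ₗ[ℂ] r) (Br : SuperForm R) (Bp : SuperForm P)
    (ν : r →ₗ[ℂ] Module.End ℂ p) (bg : (r × p) →ₗ[ℂ] (r × p) →ₗ[ℂ] (r × p)) : Prop where
  quadratic : IsQuadraticLieSuper (Br.prod Bp) bg
  subalgebra : ∀ x x' : r, bg (x, 0) (x', 0) = (br x x', 0)
  action : ∀ (x : r) (y : p), bg (x, 0) (0, y) = (0, ν x y)

/-- The pair `(ν, (·,·)_g)` is of Lie super type. -/
def IsOfLieSuperType (br : r →ₗ[ℂ] r →ₗ[ℂ] r) (Br : SuperForm R) (Bp : SuperForm P)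
    (ν : r →ₗ[ℂ] Module.End ℂ p) : Prop :=
  ∃ bg : (r × p) →ₗ[ℂ] (r × p) →ₗ[ℂ] (r × p), IsLieSuperTypeBracket br Br Bp ν bg

/-- The inclusion `Λ(r) → Λ(r ⊕ p)`. -/
noncomputable def extInl (R : SuperSpace r) (P : SuperSpace p) :
    SExterior R →ₐ[ℂ] SExterior (R.prod P) :=
  extMap R (R.prod P) (LinearMap.inl ℂ r p) (fun a _ hx => ⟨hx, (P.part a).zero_mem⟩)

/-- The inclusion `Λ(p) → Λ(r ⊕ p)`. -/
noncomputable def extInr (R : SuperSpace r) (P : SuperSpace p) :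
    SExterior P →ₐ[ℂ] SExterior (R.prod P) :=
  extMap P (R.prod P) (LinearMap.inr ℂ r p) (fun a _ hx => ⟨(R.part a).zero_mem, hx⟩)

/-- `φ_ν = ∑ ν_*(xᵢ) ∧ xⁱ`. -/
noncomputable def phiNu (R : SuperSpace r) (P : SuperSpace p) (νs : r →ₗ[ℂ] SExterior P)
    {ι : Type*} [Fintype ι] (x x' : ι → r) : SExterior (R.prod P) :=
  ∑ i, extInr R P (νs (x i)) * extInl R P (zeta 0 (x' i))

/-- The set of the `φ_p ∈ Λ³(p)`, even and `r`-invariant, such that `ν_*(Cas_r) + φ_p²` is a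
scalar. -/
def constancySet {br : r →ₗ[ℂ] r →ₗ[ℂ] r} {Bp : SuperForm P}
    {ν : r →ₗ[ℂ] Module.End ℂ p} {νs : r →ₗ[ℂ] SExterior P} (h : IsNuStar R br Bp ν νs)
    {ι : Type*} [Fintype ι] (x x' : ι → r) : Set (SExterior P) :=
  {φp | φp ∈ extPart P 3 0 ∧
    (∀ (a : ZMod 2) (z : r), z ∈ R.part a → ccomm Bp a 0 (νs z) φp = 0) ∧
    ∃ c : ℂ, eta Bp (nuStarEnv h (casimir R br x x')) + cmul Bp φp φp
      = algebraMap ℂ (SExterior P) c}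

end kostant

end SuperKostant

namespace SuperKostant

/-! Contraction turns $\phi\in\Lambda^3_{\bar 0}(V)$ into an even, super-skew, invariant bracket:
$2\iota(x)\iota(y)\iota(z)\phi$ is the scalar $(x,[y,z])$, and contractions super-anticommute. For a
non-degenerate form every such bracket arises from exactly one $\phi$ (`exists_cubic`, `cubic_ext`).
The inverse is a Poincaré lemma: a closed map $V\to\Lambda^n(V)$ is integrated by wedging with a
dual basis and dividing by the degree $n+1$ (`contr_primitive`). The same integration in degree two
produces $\nu_*$ from $\nu$.

A bracket on $\mathfrak g$ with all the required properties except the Jacobi identity is determined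
by its component $K:\mathfrak p\times\mathfrak p\to\mathfrak p$. Indeed, $\mathfrak r$ and $\nu$ are
given, and invariance forces the component $\beta:\mathfrak p\times\mathfrak p\to\mathfrak r$ by
$(x,\beta(y,z))=(\nu(x)y,z)$. The bracket of $\phi_{\mathfrak r}+\phi_\nu+\phi_{\mathfrak p}$ is
such an extension, and its $K$ is the bracket of $\phi_{\mathfrak p}$. So the candidates are
parametrized by $\Lambda^3_{\bar 0}(\mathfrak p)$.

The Jacobi identity (`jacobi_iff`) is sorted by the number of arguments in $\mathfrak p$. With none
or one it holds because $\mathfrak r$ is a Lie superalgebra and $\nu$ a representation. With two, it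
says that every $\nu(x)$ is a derivation of $K$. With three, its $\mathfrak r$-component follows
from that derivation property, and its $\mathfrak p$-component is an identity between $K$, $\nu$ and
$\beta$.

The translation rests on `contr_contr_ccomm`: for $u\in\Lambda^2$, the double contractions of
$[u,\phi]_C$ measure the failure of $[u,\cdot]_C$ to be a derivation of the bracket of $\phi$.
Taking $u=\nu_*(x)$ gives the invariance of $\phi_{\mathfrak p}$. Taking $u=\iota(y)\phi_{\mathfrak
p}$, where $\iota(y)\phi_{\mathfrak p}^2=[\iota(y)\phi_{\mathfrak p},\phi_{\mathfrak p}]_C$, shows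
that the triple contractions of $\phi_{\mathfrak p}^2$ are the Jacobiator of $K$. Those of
$\nu_*(\mathrm{Cas}_{\mathfrak r})$ supply the terms with $\beta$. An element all of whose
contractions vanish is a scalar, which gives the constancy condition. -/

theorem zmod2_one_add_one : (1 + 1 : ZMod 2) = 0 := by decide

theorem sgn_comm (a b : ZMod 2) : sgn a b = sgn b a := by simp [sgn, mul_comm]

theorem sgn_mul_self (a b : ZMod 2) : sgn a b * sgn a b = 1 := by
  rcases zmod2_cases a with rfl | rfl <;> rcases zmod2_cases b with rfl | rfl <;>
    simp [sgn_zero_left, sgn_zero_right, sgn_one_one]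

theorem sgn_add_right (a b c : ZMod 2) : sgn a (b + c) = sgn a b * sgn a c := by
  rcases zmod2_cases a with rfl | rfl <;> rcases zmod2_cases b with rfl | rfl <;>
    rcases zmod2_cases c with rfl | rfl <;>
    simp [sgn_zero_left, sgn_zero_right, sgn_one_one, zmod2_one_add_one]

theorem sgn_add_left (a b c : ZMod 2) : sgn (a + b) c = sgn a c * sgn b c := by
  rw [sgn_comm, sgn_add_right, sgn_comm c, sgn_comm c]

/-! ### Contractions, the sign automorphism and the bigrading -/

section clifford
variable {V : Type*} [AddCommGroup V] [Module ℂ V] {S : SuperSpace V}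

/-- By consistency only $a=b$ matters, and there the two signs cancel. -/
theorem form_sgn_mul_self (B : SuperForm S) {a b : ZMod 2} {x y : V} (hx : x ∈ S.part a)
    (hy : y ∈ S.part b) (c : ZMod 2) : sgn c a * sgn c b * B.form x y = B.form x y := by
  by_cases h : a = b
  · rw [h, sgn_mul_self, one_mul]
  · rw [B.consistent a b x y hx hy h, mul_zero]

theorem pr_mem (S : SuperSpace V) (a : ZMod 2) (x : V) : S.pr a x ∈ S.part a := by
  obtain ⟨y, hy, z, hz, rfl⟩ := S.exists_add x
  rcases zmod2_cases a with rfl | rfl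
  · rw [map_add, S.pr_same hy, S.pr_ne hz (by decide), add_zero]; exact hy
  · rw [map_add, S.pr_same hz, S.pr_ne hy (by decide), zero_add]; exact hz

theorem pr_add_pr (S : SuperSpace V) (x : V) : S.pr 0 x + S.pr 1 x = x := by
  obtain ⟨y, hy, z, hz, rfl⟩ := S.exists_add x
  rw [map_add, map_add, S.pr_same hy, S.pr_same hz, S.pr_ne hz (by decide),
    S.pr_ne hy (by decide)]
  simp

theorem clifford_ext {B : SuperForm S} {W : Type*} [AddCommGroup W] [Module ℂ W]
    {f g : SClifford B →ₗ[ℂ] W} (h1 : f 1 = g 1)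
    (h : ∀ (a : ZMod 2) (x : V) (u : SClifford B), x ∈ S.part a → f u = g u →
      f (zeta B x * u) = g (zeta B x * u)) (u : SClifford B) : f u = g u :=
  SClifford.induction (LinearMap.eqLocus f g) h1 h u

/-- The automorphism of the Clifford algebra that multiplies an element of degree `n` and
parity `a` by `(-1)^{n + ab}`. -/
noncomputable def theta (B : SuperForm S) (b : ZMod 2) : SClifford B →ₐ[ℂ] SClifford B :=
  SClifford.lift B (-(zeta B ∘ₗ S.twist b)) (by
    intro a a' x y hx hy
    have h := congrArg ((sgn b a * sgn b a') • ·) (zeta_rel B hx hy)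
    simp only [LinearMap.neg_apply, LinearMap.comp_apply, S.twist_apply hx, S.twist_apply hy,
      map_smul, neg_mul_neg, smul_mul_smul_comm]
    rw [Algebra.algebraMap_eq_smul_one] at h ⊢
    simp only [smul_smul] at h
    -- Only vectors of equal parity pair non-trivially, so the twist does not change the scalar side
    -- of the relation.
    rw [show sgn b a * sgn b a' * (2 * B.form x y) = 2 * B.form x y by
      rw [mul_left_comm, form_sgn_mul_self B hx hy]] at h
    rw [← h]
    module)

theorem theta_zeta (B : SuperForm S) (b : ZMod 2) {a : ZMod 2} {x : V} (hx : x ∈ S.part a) :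
    theta B b (zeta B x) = -(sgn b a • zeta B x) := by
  simp [theta, SClifford.lift_zeta, S.twist_apply hx]

/-- The map `theta B b` collects the signs that arise when $\iota(y)$ passes all the factors of $u$.
The forms $B$ and $D$ are independent, so the rule covers both the exterior and the Clifford
product. -/
theorem contr_mul (B D : SuperForm S) {b : ZMod 2} {y : V} (hy : y ∈ S.part b)
    (u v : SClifford B) :
    contr B D y (u * v) = contr B D y u * v + theta B b u * contr B D y v := by
  refine clifford_ext (f := contr B D y ∘ₗ LinearMap.mulRight ℂ v)
    (g := LinearMap.mulRight ℂ v ∘ₗ contr B D y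
      + LinearMap.mulRight ℂ (contr B D y v) ∘ₗ (theta B b).toLinearMap) ?_ ?_ u
  · simp [contr_one]
  · intro a x u hx hu
    simp only [LinearMap.comp_apply, LinearMap.mulRight_apply, LinearMap.add_apply,
      AlgHom.toLinearMap_apply] at hu ⊢
    rw [mul_assoc, contr_zeta_mul B D hy hx, contr_zeta_mul B D hy hx, hu, map_mul,
      theta_zeta B b hx]
    simp only [mul_add, sub_mul, smul_mul_assoc, neg_mul, mul_assoc]
    module

/-- A contraction changes the degree by one and the parity by $|y|$, whence the sign $-(-1)^{ab}$.
-/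
theorem contr_theta (B D : SuperForm S) {b : ZMod 2} {y : V} (hy : y ∈ S.part b) (a : ZMod 2)
    (u : SClifford B) :
    contr B D y (theta B a u) = -(sgn a b • theta B a (contr B D y u)) := by
  refine clifford_ext (f := contr B D y ∘ₗ (theta B a).toLinearMap)
    (g := -(sgn a b • ((theta B a).toLinearMap ∘ₗ contr B D y))) ?_ ?_ u
  · simp [contr_one]
  · intro c x u hx hu
    simp only [LinearMap.comp_apply, LinearMap.neg_apply, LinearMap.smul_apply,
      AlgHom.toLinearMap_apply] at hu ⊢
    rw [map_mul, theta_zeta B a hx, neg_mul, smul_mul_assoc, map_neg, map_smul,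
      contr_zeta_mul B D hy hx, hu, contr_zeta_mul B D hy hx, map_sub, map_smul, map_smul, map_mul,
      theta_zeta B a hx]
    have h := D.consistent b c y x hy hx
    simp only [mul_neg, mul_smul_comm, neg_mul, smul_mul_assoc]
    by_cases e : b = c
    · subst e
      module
    · rw [h e]; module

/-- Carrying $y$ to the right through $v$ by the Clifford relations leaves a term $2(y,x)$ at each
factor $x$; together these make up $2\iota(y)v$. -/
theorem zeta_mul_comm (B : SuperForm S) {b : ZMod 2} {y : V} (hy : y ∈ S.part b)
    (v : SClifford B) :
    zeta B y * v = theta B b v * zeta B y + (2 : ℂ) • contr B B y v := by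
  refine clifford_ext (f := LinearMap.mulLeft ℂ (zeta B y))
    (g := LinearMap.mulRight ℂ (zeta B y) ∘ₗ (theta B b).toLinearMap
      + (2 : ℂ) • contr B B y) ?_ ?_ v
  · simp [contr_one]
  · intro c x u hx hu
    simp only [LinearMap.comp_apply, LinearMap.add_apply, LinearMap.smul_apply,
      AlgHom.toLinearMap_apply, LinearMap.mulLeft_apply, LinearMap.mulRight_apply] at hu ⊢
    have h := congrArg (· * u) (zeta_rel B hy hx)
    have h' := congrArg (zeta B x * ·) hu
    simp only [add_mul, smul_mul_assoc, mul_assoc, ← Algebra.smul_def, mul_add,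
      mul_smul_comm] at h h'
    rw [map_mul, theta_zeta B b hx, contr_zeta_mul B B hy hx]
    simp only [neg_mul, smul_mul_assoc, mul_assoc]
    linear_combination (norm := module) h - sgn b c • h'

/-- The hypothesis says that $y$ represents the pullback along $f$ of the functional $(z,\cdot)$;
both sides then follow the same recursion on products. -/
theorem contr_map_zeta {W : Type*} [AddCommGroup W] [Module ℂ W] {T : SuperSpace W}
    (B : SuperForm S) (C : SuperForm T) (f : V →ₗ[ℂ] W)
    (hf : ∀ a x, x ∈ S.part a → f x ∈ T.part a) {b : ZMod 2} {y : V} {z : W}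
    (hy : y ∈ S.part b) (hz : z ∈ T.part b) (h : ∀ v, C.form z (f v) = B.form y v)
    (u : SExterior S) :
    contr 0 C z (extMap S T f hf u) = extMap S T f hf (contr 0 B y u) := by
  refine clifford_ext (f := contr 0 C z ∘ₗ (extMap S T f hf).toLinearMap)
    (g := (extMap S T f hf).toLinearMap ∘ₗ contr 0 B y) ?_ ?_ u
  · simp [contr_one]
  · intro a x u hx hu
    have e : extMap S T f hf (zeta 0 x) = zeta 0 (f x) := SClifford.lift_zeta ..
    simp only [LinearMap.comp_apply, AlgHom.toLinearMap_apply] at hu ⊢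
    rw [map_mul, e, contr_zeta_mul 0 C hz (hf a x hx), contr_zeta_mul 0 B hy hx, hu, h, map_sub,
      map_smul, map_smul, map_mul, e]

theorem eta_one (B : SuperForm S) : eta B 1 = 1 := changeForm_one ..

theorem eta_zeta_mul (B : SuperForm S) (x : V) (u : SClifford B) :
    eta B (zeta B x * u) = zeta 0 x * eta B u + contr 0 B x (eta B u) :=
  changeForm_zeta_mul ..

theorem eta_zeta (B : SuperForm S) (x : V) : eta B (zeta B x) = zeta 0 x := by
  have := eta_zeta_mul B x 1
  rwa [eta_one, mul_one, mul_one, contr_one, add_zero] at this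

theorem eta_contr (B : SuperForm S) {a : ZMod 2} {x : V} (hx : x ∈ S.part a) (u : SClifford B) :
    eta B (contr B B x u) = contr 0 B x (eta B u) :=
  changeForm_contr B 0 B B (form_zero_add B) hx u

/-- The two terms of $\gamma(x)=x\wedge\cdot+\iota(x)$ shift the degree by $\pm1$ and the parity by
$|x|$, so both acquire the same sign. -/
theorem eta_theta (B : SuperForm S) (b : ZMod 2) (u : SClifford B) :
    eta B (theta B b u) = theta 0 b (eta B u) := by
  refine clifford_ext (f := (eta B).toLinearMap ∘ₗ (theta B b).toLinearMap)
    (g := (theta 0 b).toLinearMap ∘ₗ (eta B).toLinearMap) ?_ ?_ u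
  · simp [eta_one]
  · intro a x u hx hu
    simp only [LinearMap.comp_apply, AlgHom.toLinearMap_apply, LinearEquiv.coe_coe] at hu ⊢
    rw [map_mul, theta_zeta B b hx, neg_mul, smul_mul_assoc, map_neg, map_smul, eta_zeta_mul, hu,
      eta_zeta_mul, map_add, map_mul, theta_zeta 0 b hx, contr_theta 0 B hx]
    simp only [neg_mul, smul_mul_assoc, smul_add, smul_neg, smul_smul, sgn_mul_self, one_smul]
    module

/-! ### The Clifford product on the exterior algebra -/

theorem add_cmul (B : SuperForm S) (u u' v : SExterior S) :
    cmul B (u + u') v = cmul B u v + cmul B u' v := by simp [cmul, add_mul]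

theorem cmul_add (B : SuperForm S) (u v v' : SExterior S) :
    cmul B u (v + v') = cmul B u v + cmul B u v' := by simp [cmul, mul_add]

theorem sub_cmul (B : SuperForm S) (u u' v : SExterior S) :
    cmul B (u - u') v = cmul B u v - cmul B u' v := by simp [cmul, sub_mul]

theorem cmul_sub (B : SuperForm S) (u v v' : SExterior S) :
    cmul B u (v - v') = cmul B u v - cmul B u v' := by simp [cmul, mul_sub]

theorem smul_cmul (B : SuperForm S) (c : ℂ) (u v : SExterior S) :
    cmul B (c • u) v = c • cmul B u v := by simp [cmul]

theorem cmul_smul (B : SuperForm S) (c : ℂ) (u v : SExterior S) :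
    cmul B u (c • v) = c • cmul B u v := by simp [cmul]

theorem cmul_assoc (B : SuperForm S) (u v w : SExterior S) :
    cmul B (cmul B u v) w = cmul B u (cmul B v w) := by simp [cmul, mul_assoc]

theorem zeta_cmul (B : SuperForm S) (y : V) (v : SExterior S) :
    cmul B (zeta 0 y) v = zeta 0 y * v + contr 0 B y v := by
  have h : (eta B).symm (zeta 0 y) = zeta B y := by rw [LinearEquiv.symm_apply_eq, eta_zeta]
  rw [cmul, h, eta_zeta_mul, LinearEquiv.apply_symm_apply]

theorem contr_eta_symm (B : SuperForm S) {b : ZMod 2} {y : V} (hy : y ∈ S.part b)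
    (u : SExterior S) : contr B B y ((eta B).symm u) = (eta B).symm (contr 0 B y u) := by
  rw [LinearEquiv.eq_symm_apply, eta_contr B hy, LinearEquiv.apply_symm_apply]

theorem theta_eta_symm (B : SuperForm S) (b : ZMod 2) (u : SExterior S) :
    theta B b ((eta B).symm u) = (eta B).symm (theta 0 b u) := by
  rw [LinearEquiv.eq_symm_apply, eta_theta, LinearEquiv.apply_symm_apply]

/-- Since $\eta$ commutes with contractions, $\iota(y)$ is a twisted derivation of the Clifford
product on $\Lambda(V)$ as well. This makes the contractions of $\phi^2$ and of
$\nu_*(\mathrm{Cas}_{\mathfrak r})$ computable. -/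
theorem contr_cmul (B : SuperForm S) {b : ZMod 2} {y : V} (hy : y ∈ S.part b)
    (u v : SExterior S) :
    contr 0 B y (cmul B u v) = cmul B (contr 0 B y u) v + cmul B (theta 0 b u) (contr 0 B y v) := by
  rw [cmul, ← eta_contr B hy, contr_mul B B hy, map_add, contr_eta_symm B hy, contr_eta_symm B hy,
    theta_eta_symm]
  rfl

theorem zeta_cmul_comm (B : SuperForm S) {b : ZMod 2} {y : V} (hy : y ∈ S.part b)
    (v : SExterior S) :
    cmul B (zeta 0 y) v = cmul B (theta 0 b v) (zeta 0 y) + (2 : ℂ) • contr 0 B y v := by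
  have h : (eta B).symm (zeta 0 y) = zeta B y := by rw [LinearEquiv.symm_apply_eq, eta_zeta]
  rw [cmul, cmul, h, zeta_mul_comm B hy, contr_eta_symm B hy, theta_eta_symm]
  simp

/-! ### The bigrading of the exterior algebra -/

theorem one_mem_extPart (S : SuperSpace V) : (1 : SExterior S) ∈ extPart S 0 0 :=
  Submodule.subset_span ⟨Fin.elim0, Fin.elim0, fun i => i.elim0, by simp, by simp⟩

theorem extPart_zero_le (S : SuperSpace V) (a : ZMod 2) :
    extPart S 0 a ≤ Submodule.span ℂ {1} := by
  refine Submodule.span_mono ?_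
  rintro _ ⟨d, x, -, -, rfl⟩
  simp

theorem zeta_mul_mem_extPart {n : ℕ} {a b : ZMod 2} {y : V} (hy : y ∈ S.part b)
    {u : SExterior S} (hu : u ∈ extPart S n a) : zeta 0 y * u ∈ extPart S (n + 1) (b + a) := by
  have : extPart S n a ≤ (extPart S (n + 1) (b + a)).comap (LinearMap.mulLeft ℂ (zeta 0 y)) := by
    refine Submodule.span_le.2 ?_
    rintro _ ⟨d, x, hx, hd, rfl⟩
    refine Submodule.subset_span ⟨Fin.cons b d, Fin.cons y x, ?_, ?_, ?_⟩
    · intro i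
      refine Fin.cases ?_ (fun i => ?_) i
      · simpa using hy
      · simpa using hx i
    · simp [Fin.sum_univ_succ, hd]
    · simp [List.ofFn_succ]
  exact this hu

theorem zeta_mem_extPart {b : ZMod 2} {y : V} (hy : y ∈ S.part b) :
    zeta 0 y ∈ extPart S 1 b := by
  simpa using zeta_mul_mem_extPart hy (one_mem_extPart S)

/-- Splitting off the first factor is the induction step for the grading. The parity $c$ of the
remainder varies, so the inductions below generalize over the parity. -/
theorem extPart_succ_le {n : ℕ} {a : ZMod 2} (Q : Submodule ℂ (SExterior S))
    (h : ∀ (b c : ZMod 2) (y : V) (u : SExterior S), y ∈ S.part b → u ∈ extPart S n c →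
      b + c = a → zeta 0 y * u ∈ Q) : extPart S (n + 1) a ≤ Q := by
  refine Submodule.span_le.2 ?_
  rintro _ ⟨d, x, hx, hd, rfl⟩
  rw [List.ofFn_succ, List.prod_cons]
  rw [Fin.sum_univ_succ] at hd
  exact h (d 0) _ (x 0) _ (hx 0)
    (Submodule.subset_span ⟨fun i => d i.succ, fun i => x i.succ, fun i => hx _, rfl, rfl⟩) hd

theorem extPart_one_le (S : SuperSpace V) (a : ZMod 2) :
    extPart S 1 a ≤ (S.part a).map (zeta 0) := by
  refine Submodule.span_le.2 ?_
  rintro _ ⟨d, x, hx, hd, rfl⟩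
  refine ⟨x 0, ?_, by simp⟩
  have : d 0 = a := by simpa using hd
  exact this ▸ hx 0

theorem theta_of_mem {n : ℕ} {a : ZMod 2} (b : ZMod 2) {u : SExterior S}
    (hu : u ∈ extPart S n a) : theta 0 b u = ((-1) ^ n * sgn b a) • u := by
  suffices extPart S n a ≤ LinearMap.eqLocus (theta 0 b).toLinearMap
      (((-1) ^ n * sgn b a) • LinearMap.id) from this hu
  clear hu u
  induction n generalizing a with
  | zero =>
    refine Submodule.span_le.2 ?_
    rintro _ ⟨d, x, -, hd, rfl⟩
    have : a = 0 := by simpa using hd.symm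
    simp [this, sgn_zero_right]
  | succ n ih =>
    refine extPart_succ_le _ fun c d y u hy hu hcd => ?_
    have h := ih hu
    simp only [LinearMap.mem_eqLocus, AlgHom.toLinearMap_apply, LinearMap.smul_apply,
      LinearMap.id_apply] at h ⊢
    rw [map_mul, theta_zeta 0 b hy, h, ← hcd, sgn_add_right, pow_succ]
    simp only [neg_mul, smul_mul_assoc, mul_smul_comm]
    module

theorem contr_mem_extPart (B : SuperForm S) {n : ℕ} {a b : ZMod 2} {y : V} (hy : y ∈ S.part b)
    {u : SExterior S} (hu : u ∈ extPart S (n + 1) a) : contr 0 B y u ∈ extPart S n (b + a) := by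
  suffices extPart S (n + 1) a ≤ (extPart S n (b + a)).comap (contr 0 B y) from this hu
  clear hu u
  induction n generalizing a with
  | zero =>
    refine extPart_succ_le _ fun c d x u hx hu hcd => ?_
    have hx' : x ∈ S.part c := hx
    obtain ⟨k, rfl⟩ := Submodule.mem_span_singleton.1 (extPart_zero_le S d hu)
    rw [Submodule.mem_comap, contr_zeta_mul 0 B hy hx, map_smul, contr_one]
    simp only [smul_zero, mul_zero, sub_zero]
    -- A non-zero pairing forces $b=c$, and then $b+(c+d)=d$ in $\mathbb Z/2$.
    by_cases h : b = c
    · subst h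
      rw [← hcd, ← add_assoc, CharTwo.add_self_eq_zero, zero_add]
      exact Submodule.smul_mem _ _ hu
    · rw [B.consistent b c y x hy hx h, zero_smul]; exact Submodule.zero_mem _
  | succ n ih =>
    refine extPart_succ_le _ fun c d x u hx hu hcd => ?_
    rw [Submodule.mem_comap, contr_zeta_mul 0 B hy hx]
    refine Submodule.sub_mem _ ?_ (Submodule.smul_mem _ _ ?_)
    · by_cases h : b = c
      · subst h
        rw [← hcd, ← add_assoc, CharTwo.add_self_eq_zero, zero_add]
        exact Submodule.smul_mem _ _ hu
      · rw [B.consistent b c y x hy hx h, zero_smul]; exact Submodule.zero_mem _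
    · have := zeta_mul_mem_extPart hx (ih hu)
      rwa [show c + (b + d) = b + a by rw [← hcd]; ring] at this

theorem mul_zeta_mem_extPart {n : ℕ} {a b : ZMod 2} {y : V} (hy : y ∈ S.part b)
    {u : SExterior S} (hu : u ∈ extPart S n a) : u * zeta 0 y ∈ extPart S (n + 1) (a + b) := by
  have h := zeta_mul_comm 0 hy u
  -- For the zero form the contraction term disappears, and `zeta_mul_comm` becomes
  -- super-commutativity.
  have h0 : contr (0 : SuperForm S) 0 y u = 0 := by
    refine clifford_ext (f := contr 0 0 y) (g := 0) (contr_one ..) (fun c x u hx hu => ?_) u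
    rw [contr_zeta_mul 0 0 hy hx, hu]
    have : (0 : SuperForm S).form y x = 0 := rfl
    simp [this]
  rw [h0, smul_zero, add_zero, theta_of_mem b hu, smul_mul_assoc] at h
  have h2 : u * zeta 0 y = ((-1) ^ n * sgn b a) • (zeta 0 y * u) := by
    rw [h, smul_smul, mul_mul_mul_comm, sgn_mul_self, mul_one, ← mul_pow]
    simp
  rw [h2, add_comm a b]
  exact Submodule.smul_mem _ _ (zeta_mul_mem_extPart hy hu)

theorem extMap_mem_extPart {W : Type*} [AddCommGroup W] [Module ℂ W] {T : SuperSpace W}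
    (f : V →ₗ[ℂ] W) (hf : ∀ a x, x ∈ S.part a → f x ∈ T.part a) {n : ℕ} {a : ZMod 2}
    {u : SExterior S} (hu : u ∈ extPart S n a) : extMap S T f hf u ∈ extPart T n a := by
  suffices extPart S n a ≤ (extPart T n a).comap (extMap S T f hf).toLinearMap from this hu
  refine Submodule.span_le.2 ?_
  rintro _ ⟨d, x, hx, hd, rfl⟩
  refine Submodule.subset_span ⟨d, fun i => f (x i), fun i => hf _ _ (hx i), hd, ?_⟩
  simp only [AlgHom.toLinearMap_apply, map_list_prod, List.map_ofFn]
  congr 2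
  funext i
  exact SClifford.lift_zeta ..

end clifford
-- Dual systems, the Euler operator and integration of closed maps
section dual
variable {V : Type*} [AddCommGroup V] [Module ℂ V] {S : SuperSpace V}

/-- Two families of vectors whose tensor `∑ eᵢ ⊗ eᵢ'` is the canonical element of the
form `B`. -/
structure IsDualSystem (B : SuperForm S) {κ : Type*} [Fintype κ] (e e' : κ → V) : Prop where
  sum_left : ∀ z : V, ∑ i, B.form (e' i) z • e i = z
  sum_right : ∀ z : V, ∑ i, B.form z (e i) • e' i = z

theorem isDualSystem_of_basis (B : SuperForm S) (hB : B.form.Nondegenerate) {κ : Type*}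
    [Fintype κ] [DecidableEq κ] (e : Module.Basis κ ℂ V) (e' : κ → V)
    (h : ∀ i j, B.form (e' i) (e j) = if i = j then 1 else 0) : IsDualSystem B e e' where
  sum_left z := by
    have : ∀ i, B.form (e' i) z = e.repr z i := fun i => by
      conv_lhs => rw [← e.sum_repr z]
      simp only [map_sum, map_smul, h, smul_eq_mul, mul_ite, mul_one, mul_zero, Finset.sum_ite_eq,
        Finset.mem_univ, if_true]
    simp only [this, e.sum_repr]
  sum_right z := by
    refine sub_eq_zero.1 (hB.1 _ fun w => ?_)
    suffices B.form (∑ i, B.form z (e i) • e' i) = B.form z by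
      rw [map_sub, this, sub_self, LinearMap.zero_apply]
    refine e.ext fun j => ?_
    simp [h]

section
variable {B : SuperForm S} {κ : Type*} [Fintype κ] {e e' : κ → V}

theorem IsDualSystem.sum_left_map (h : IsDualSystem B e e') {W : Type*} [AddCommGroup W]
    [Module ℂ W] (f : V →ₗ[ℂ] W) (z : V) : ∑ i, B.form (e' i) z • f (e i) = f z := by
  conv_rhs => rw [← h.sum_left z]
  simp

theorem IsDualSystem.sum_right_map (h : IsDualSystem B e e') {W : Type*} [AddCommGroup W]
    [Module ℂ W] (f : V →ₗ[ℂ] W) (z : V) : ∑ i, B.form z (e i) • f (e' i) = f z := by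
  conv_rhs => rw [← h.sum_right z]
  simp

/-- Both sums evaluate $f$ on the canonical tensor of the form. Hence the given basis, which need
not be homogeneous, can be exchanged for a homogeneous system. -/
theorem IsDualSystem.sum_eq (h : IsDualSystem B e e') {κ' : Type*} [Fintype κ'] {x x' : κ' → V}
    (hx : IsDualSystem B x x') {W : Type*} [AddCommGroup W] [Module ℂ W]
    (f : V →ₗ[ℂ] V →ₗ[ℂ] W) : ∑ i, f (e i) (e' i) = ∑ j, f (x j) (x' j) := by
  have h1 : ∀ i, f (e i) (e' i) = ∑ j, B.form (x' j) (e i) • f (x j) (e' i) := fun i =>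
    (hx.sum_left_map (f.flip (e' i)) (e i)).symm
  simp only [h1]
  rw [Finset.sum_comm]
  exact Finset.sum_congr rfl fun j _ => h.sum_right_map (f (x j)) (x' j)

/-- Vectors pair non-trivially only in equal parity, where the sign is $(-1)^{|y|}$; the twist
expresses it linearly, without a homogeneity assumption. -/
theorem form_twist (B : SuperForm S) (x y : V) : B.form x y = B.form (S.twist 1 y) x := by
  suffices B.form = (B.form ∘ₗ S.twist 1).flip from LinearMap.congr_fun₂ this x y
  refine super_ext S fun a x hx => super_ext S fun b y hy => ?_
  rw [LinearMap.flip_apply, LinearMap.comp_apply, S.twist_apply hy, B.supersymm a b x y hx hy,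
    map_smul, LinearMap.smul_apply, smul_eq_mul]
  by_cases h : a = b
  · subst h
    rcases zmod2_cases a with rfl | rfl <;> simp [sgn_zero_right]
  · rw [B.consistent b a y x hy hx (Ne.symm h)]; simp

/-- The canonical tensor of a super-symmetric form is super-symmetric: expand $e_i$ in the $e'_j$,
then sum over $i$ first. -/
theorem IsDualSystem.sum_swap (h : IsDualSystem B e e') {W : Type*} [AddCommGroup W] [Module ℂ W]
    (f : V →ₗ[ℂ] V →ₗ[ℂ] W) : ∑ i, f (e i) (e' i) = ∑ i, f (e' i) (S.twist 1 (e i)) := by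
  have h1 : ∀ i, f (e i) (e' i) = ∑ j, B.form (e i) (e j) • f (e' j) (e' i) := fun i =>
    (h.sum_right_map (f.flip (e' i)) (e i)).symm
  simp only [h1]
  rw [Finset.sum_comm]
  refine Finset.sum_congr rfl fun j _ => ?_
  rw [← h.sum_right_map (f (e' j)) (S.twist 1 (e j))]
  exact Finset.sum_congr rfl fun i _ => by rw [form_twist B (e i) (e j)]

end

/-- A dual system of homogeneous vectors. -/
structure IsHomogDualSystem (B : SuperForm S) {κ : Type*} [Fintype κ] (d : κ → ZMod 2)
    (e e' : κ → V) : Prop extends IsDualSystem B e e' where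
  mem : ∀ i, e i ∈ S.part (d i)
  mem' : ∀ i, e' i ∈ S.part (d i)

theorem exists_homogDualSystem [FiniteDimensional ℂ V] (B : SuperForm S)
    (hB : B.form.Nondegenerate) : ∃ (n : ℕ) (d : Fin n → ZMod 2) (e e' : Fin n → V),
      IsHomogDualSystem B d e e' := by
  classical
  let b0 := Module.finBasis ℂ (S.part 0)
  let b1 := Module.finBasis ℂ (S.part 1)
  let b := (b0.prod b1).map (Submodule.prodEquivOfIsCompl _ _ S.isCompl)
  let d0 := Sum.elim (fun _ : Fin (Module.finrank ℂ (S.part 0)) => (0 : ZMod 2))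
    (fun _ : Fin (Module.finrank ℂ (S.part 1)) => (1 : ZMod 2))
  have hb : ∀ i, b i ∈ S.part (d0 i) := by
    rintro (i | i) <;> simp [b, d0]
  let σ := Fintype.equivFin (Fin (Module.finrank ℂ (S.part 0)) ⊕ Fin (Module.finrank ℂ (S.part 1)))
  have hb' : ∀ i, B.form.dualBasis hB b i ∈ S.part (d0 i) := by
    intro i
    have hn : d0 i ≠ d0 i + 1 := by
      generalize d0 i = t; revert t; decide
    -- The component of wrong parity of a dual vector pairs to zero with every basis vector. If
    -- $b_j$ has the parity of $b_i$, this is consistency. Otherwise $j\ne i$, the whole dual vector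
    -- pairs to zero with $b_j$, and so does its other component.
    have key : B.form (S.pr (d0 i + 1) (B.form.dualBasis hB b i)) = 0 := by
      refine b.ext fun j => ?_
      rw [LinearMap.zero_apply]
      by_cases hj : d0 j = d0 i
      · exact B.consistent _ _ _ _ (pr_mem S _ _) (hj ▸ hb j) hn.symm
      · have hj' : d0 j = d0 i + 1 := by
          revert hj; generalize d0 i = s; generalize d0 j = t; revert s t; decide
        have h0 : B.form (S.pr (d0 i) (B.form.dualBasis hB b i)) (b j) = 0 :=
          B.consistent _ _ _ _ (pr_mem S _ _) (hb j) (Ne.symm hj)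
        have h1 : B.form (B.form.dualBasis hB b i) (b j) = 0 := by
          rw [LinearMap.BilinForm.apply_dualBasis_left, if_neg]
          rintro rfl; exact hj rfl
        have h2 : S.pr (d0 i) (B.form.dualBasis hB b i)
            + S.pr (d0 i + 1) (B.form.dualBasis hB b i) = B.form.dualBasis hB b i := by
          have := pr_add_pr S (B.form.dualBasis hB b i)
          rcases zmod2_cases (d0 i) with h | h <;> rw [h]
          · simpa using this
          · rw [zmod2_one_add_one, add_comm]; exact this
        rw [← h2, map_add, LinearMap.add_apply, h0, zero_add] at h1
        exact h1
    have h3 : S.pr (d0 i + 1) (B.form.dualBasis hB b i) = 0 :=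
      hB.1 _ fun w => by rw [key, LinearMap.zero_apply]
    have h4 := pr_add_pr S (B.form.dualBasis hB b i)
    rcases zmod2_cases (d0 i) with h | h <;> rw [h] at h3 ⊢
    · rw [zero_add] at h3
      rw [h3, add_zero] at h4; rw [← h4]; exact pr_mem S _ _
    · rw [zmod2_one_add_one] at h3
      rw [h3, zero_add] at h4; rw [← h4]; exact pr_mem S _ _
  have hs := isDualSystem_of_basis B hB b (B.form.dualBasis hB b) fun i j => by
    rw [LinearMap.BilinForm.apply_dualBasis_left]
    simp only [eq_comm]
  refine ⟨_, d0 ∘ σ.symm, b ∘ σ.symm, B.form.dualBasis hB b ∘ σ.symm, ⟨⟨?_, ?_⟩, ?_, ?_⟩⟩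
  · intro z
    exact (Equiv.sum_comp σ.symm fun i => B.form (B.form.dualBasis hB b i) z • b i).trans
      (hs.sum_left z)
  · intro z
    exact (Equiv.sum_comp σ.symm fun i => B.form z (b i) • B.form.dualBasis hB b i).trans
      (hs.sum_right z)
  · exact fun i => hb _
  · exact fun i => hb' _

variable {B : SuperForm S} {κ : Type*} [Fintype κ] {d : κ → ZMod 2} {e e' : κ → V}

/-- The Euler operator, which multiplies the elements of degree `n` by `n`. -/
noncomputable def euler (B : SuperForm S) (e e' : κ → V) : Module.End ℂ (SExterior S) :=
  ∑ i, LinearMap.mulLeft ℂ (zeta 0 (e i)) ∘ₗ contr 0 B (e' i)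

theorem euler_apply (u : SExterior S) :
    euler B e e' u = ∑ i, zeta 0 (e i) * contr 0 B (e' i) u := by
  simp [euler]

theorem zeta_mul_zeta_mul {a b : ZMod 2} {x y : V} (hx : x ∈ S.part a) (hy : y ∈ S.part b)
    (u : SExterior S) :
    zeta 0 x * (zeta 0 y * u) = -(sgn a b • (zeta 0 y * (zeta 0 x * u))) := by
  have h := congrArg (· * u) (exterior_rel hx hy)
  simp only [add_mul, smul_mul_assoc, mul_assoc, zero_mul] at h
  exact eq_neg_of_add_eq_zero_left h

/-- The terms in which $\iota(e'_i)$ hits $y$ sum to $y\wedge u$; in the others $y$ passes $e'_i$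
and $e_i$ with equal signs. So the Euler operator is an even derivation which is the identity on
$V$. -/
theorem IsHomogDualSystem.euler_zeta_mul (h : IsHomogDualSystem B d e e') {b : ZMod 2} {y : V}
    (hy : y ∈ S.part b) (u : SExterior S) :
    euler B e e' (zeta 0 y * u) = zeta 0 y * u + zeta 0 y * euler B e e' u := by
  have h1 : ∀ i, zeta 0 (e i) * contr 0 B (e' i) (zeta 0 y * u)
      = B.form (e' i) y • (zeta 0 (e i) * u)
        + zeta 0 y * (zeta 0 (e i) * contr 0 B (e' i) u) := fun i => by
    rw [contr_zeta_mul 0 B (h.mem' i) hy, mul_sub, mul_smul_comm, mul_smul_comm,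
      zeta_mul_zeta_mul (h.mem i) hy, smul_neg, smul_smul, sgn_mul_self, one_smul, sub_neg_eq_add]
  simp only [euler_apply, h1, Finset.sum_add_distrib, Finset.mul_sum]
  have h2 := h.sum_left_map (LinearMap.mulRight ℂ u ∘ₗ zeta 0) y
  simp only [LinearMap.comp_apply, LinearMap.mulRight_apply] at h2
  rw [h2]

theorem euler_one : euler B e e' 1 = 0 := by simp [euler_apply, contr_one]

theorem IsHomogDualSystem.euler_of_mem (h : IsHomogDualSystem B d e e') {n : ℕ} {a : ZMod 2}
    {u : SExterior S} (hu : u ∈ extPart S n a) : euler B e e' u = (n : ℂ) • u := by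
  suffices extPart S n a ≤ LinearMap.eqLocus (euler B e e') ((n : ℂ) • LinearMap.id) from this hu
  clear hu u
  induction n generalizing a with
  | zero =>
    refine (extPart_zero_le S a).trans ((Submodule.span_singleton_le_iff_mem _ _).2 ?_)
    simp [euler_one]
  | succ n ih =>
    refine extPart_succ_le _ fun b c y u hy hu _ => ?_
    have := ih hu
    simp only [LinearMap.mem_eqLocus, LinearMap.smul_apply, LinearMap.id_apply] at this ⊢
    rw [h.euler_zeta_mul hy, this, mul_smul_comm]
    push_cast
    module

/-- An element of positive degree is zero if its contractions are zero. -/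
theorem eq_zero_of_contr [FiniteDimensional ℂ V] (hB : B.form.Nondegenerate) {n : ℕ} {a : ZMod 2}
    {u : SExterior S} (hu : u ∈ extPart S (n + 1) a)
    (h : ∀ (b : ZMod 2) (y : V), y ∈ S.part b → contr 0 B y u = 0) : u = 0 := by
  obtain ⟨m, d, e, e', hd⟩ := exists_homogDualSystem B hB
  have h1 := hd.euler_of_mem hu
  rw [euler_apply, Finset.sum_eq_zero fun i _ => by rw [h _ _ (hd.mem' i), mul_zero]] at h1
  exact (smul_eq_zero.1 h1.symm).resolve_left (by exact_mod_cast n.succ_ne_zero)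

/-- An element of the exterior algebra is a scalar if its contractions are zero. -/
theorem eq_algebraMap_of_contr [FiniteDimensional ℂ V] (hB : B.form.Nondegenerate)
    {u : SExterior S} (h : ∀ (b : ZMod 2) (y : V), y ∈ S.part b → contr 0 B y u = 0) :
    ∃ c : ℂ, u = algebraMap ℂ _ c := by
  obtain ⟨m, d, e, e', hd⟩ := exists_homogDualSystem B hB
  set E := euler B e e' with hE
  have hu : E u = 0 := by
    rw [hE, euler_apply]
    exact Finset.sum_eq_zero fun i _ => by rw [h _ _ (hd.mem' i), mul_zero]
  have hmul : ∀ (a : ZMod 2) (x : V) (n : ℕ), x ∈ S.part a →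
      ∀ v ∈ Module.End.eigenspace E (n : ℂ), zeta 0 x * v
        ∈ Module.End.eigenspace E ((n + 1 : ℕ) : ℂ) := by
    intro a x n hx v hv
    rw [Module.End.mem_eigenspace_iff] at hv ⊢
    rw [hE, hd.euler_zeta_mul hx, ← hE, hv, mul_smul_comm]
    push_cast
    module
  have h1 : (1 : SExterior S) ∈ Module.End.eigenspace E ((0 : ℕ) : ℂ) := by
    rw [Module.End.mem_eigenspace_iff, hE, euler_one]; simp
  -- Wedging with a vector raises the Euler eigenvalue by one, so $1$ and the eigenspaces of
  -- positive integers span $\Lambda(V)$. As $Eu=0$, the non-scalar part of $u$ lies in the kernel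
  -- of $E$ and vanishes by independence of eigenspaces.
  have hmem : u ∈ Submodule.span ℂ {(1 : SExterior S)}
      ⊔ ⨆ n : ℕ, Module.End.eigenspace E ((n + 1 : ℕ) : ℂ) := by
    refine SClifford.induction _
      (Submodule.mem_sup_left (Submodule.mem_span_singleton_self _)) (fun a x u hx hu => ?_) u
    refine Submodule.mem_sup_right ?_
    suffices Submodule.span ℂ {(1 : SExterior S)}
        ⊔ ⨆ n : ℕ, Module.End.eigenspace E ((n + 1 : ℕ) : ℂ)
        ≤ (⨆ n : ℕ, Module.End.eigenspace E ((n + 1 : ℕ) : ℂ)).comap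
          (LinearMap.mulLeft ℂ (zeta 0 x)) from this hu
    refine sup_le ((Submodule.span_singleton_le_iff_mem _ _).2 ?_) (iSup_le fun n v hv => ?_)
    · exact Submodule.mem_iSup_of_mem 0 (hmul a x 0 hx 1 h1)
    · exact Submodule.mem_iSup_of_mem (n + 1) (hmul a x (n + 1) hx v hv)
  obtain ⟨v, hv, w, hw, rfl⟩ := Submodule.mem_sup.1 hmem
  obtain ⟨c, rfl⟩ := Submodule.mem_span_singleton.1 hv
  have hw0 : w ∈ Module.End.eigenspace E 0 := by
    rw [Module.End.mem_eigenspace_iff, zero_smul]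
    rwa [map_add, map_smul, hE, euler_one, smul_zero, zero_add] at hu
  have hle : (⨆ n : ℕ, Module.End.eigenspace E ((n + 1 : ℕ) : ℂ))
      ≤ ⨆ (μ : ℂ) (_ : μ ≠ 0), Module.End.eigenspace E μ :=
    iSup_le fun n => le_iSup₂_of_le ((n + 1 : ℕ) : ℂ) (by exact_mod_cast n.succ_ne_zero) le_rfl
  have := Submodule.disjoint_def.1 ((Module.End.eigenspaces_iSupIndep E) 0) w hw0 (hle hw)
  exact ⟨c, by rw [this, add_zero, Algebra.algebraMap_eq_smul_one]⟩

/-- The element `u = (n + 1)⁻¹ ∑ eᵢ ∧ f(eᵢ')`, which has the contractions `f(y)` if `f` takes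
its values in the degree `n` and is closed. -/
noncomputable def primitive (e e' : κ → V) (n : ℕ) : (V →ₗ[ℂ] SExterior S) →ₗ[ℂ] SExterior S :=
  ((n : ℂ) + 1)⁻¹ • ∑ i, LinearMap.mulLeft ℂ (zeta 0 (e i)) ∘ₗ LinearMap.applyₗ (e' i)

theorem primitive_apply (n : ℕ) (f : V →ₗ[ℂ] SExterior S) :
    primitive e e' n f = ((n : ℂ) + 1)⁻¹ • ∑ i, zeta 0 (e i) * f (e' i) := by
  simp [primitive]

theorem IsHomogDualSystem.primitive_mem (h : IsHomogDualSystem B d e e') {n : ℕ} {a : ZMod 2}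
    {f : V →ₗ[ℂ] SExterior S}
    (hf : ∀ (b : ZMod 2) (y : V), y ∈ S.part b → f y ∈ extPart S n (b + a)) :
    primitive e e' n f ∈ extPart S (n + 1) a := by
  rw [primitive_apply]
  refine Submodule.smul_mem _ _ (Submodule.sum_mem _ fun i _ => ?_)
  have := zeta_mul_mem_extPart (h.mem i) (hf _ _ (h.mem' i))
  rwa [← add_assoc, CharTwo.add_self_eq_zero, zero_add] at this

/-- Poincaré lemma: closedness exchanges $y$ and $e'_i$, so contracting $\sum e_i\wedge f(e'_i)$
gives $f(y)$ plus the Euler operator applied to $f(y)$, that is $(n+1)f(y)$. -/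
theorem IsHomogDualSystem.contr_primitive (h : IsHomogDualSystem B d e e') {n : ℕ} {a : ZMod 2}
    {f : V →ₗ[ℂ] SExterior S}
    (hf : ∀ (b : ZMod 2) (y : V), y ∈ S.part b → f y ∈ extPart S n (b + a))
    (hclosed : ∀ (b c : ZMod 2) (y z : V), y ∈ S.part b → z ∈ S.part c →
      contr 0 B y (f z) = -(sgn b c • contr 0 B z (f y)))
    {b : ZMod 2} {y : V} (hy : y ∈ S.part b) :
    contr 0 B y (primitive e e' n f) = f y := by
  have h1 : ∀ i, contr 0 B y (zeta 0 (e i) * f (e' i))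
      = B.form y (e i) • f (e' i) + zeta 0 (e i) * contr 0 B (e' i) (f y) := fun i => by
    rw [contr_zeta_mul 0 B hy (h.mem i), hclosed _ _ _ _ hy (h.mem' i), mul_neg, smul_neg,
      mul_smul_comm, smul_smul, sgn_mul_self, one_smul, sub_neg_eq_add]
  rw [primitive_apply, map_smul, map_sum]
  simp only [h1, Finset.sum_add_distrib]
  rw [h.sum_right_map f y, ← euler_apply, h.euler_of_mem (hf b y hy)]
  have : (n : ℂ) + 1 ≠ 0 := by exact_mod_cast n.succ_ne_zero
  rw [show f y + (n : ℂ) • f y = ((n : ℂ) + 1) • f y by module, smul_smul, inv_mul_cancel₀ this,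
    one_smul]

end dual
-- Clifford commutators with elements of degree two, and brackets of cubic elements
section commutator
variable {V : Type*} [AddCommGroup V] [Module ℂ V] {S : SuperSpace V}

theorem zeta_injective (S : SuperSpace V) : Function.Injective (zeta (0 : SuperForm S)) :=
  Function.LeftInverse.injective (g := extToV S) extToV_zeta

/-- The augmentation $\Lambda(V)\to\mathbb C$ that kills $V$ recovers the scalar. -/
theorem scalar_injective (S : SuperSpace V) {c c' : ℂ}
    (h : c • (1 : SExterior S) = c' • 1) : c = c' := by
  have := congrArg (SClifford.lift (0 : SuperForm S) (0 : V →ₗ[ℂ] ℂ) (fun a b x y _ _ => by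
    have : (0 : SuperForm S).form x y = 0 := rfl
    simp [this])) h
  simpa using this

theorem exists_zeta_eq {a : ZMod 2} {u : SExterior S} (hu : u ∈ extPart S 1 a) :
    ∃ y ∈ S.part a, zeta 0 y = u := extPart_one_le S a hu

theorem mem_part_of_zeta_mem {a : ZMod 2} {y : V} (hy : zeta 0 y ∈ extPart S 1 a) :
    y ∈ S.part a := by
  obtain ⟨z, hz, h⟩ := exists_zeta_eq hy
  rwa [← zeta_injective S h]

/-- The supercommutator as a linear map of its second argument. -/
noncomputable def ccommRight (B : SuperForm S) (a b : ZMod 2) (u : SExterior S) :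
    SExterior S →ₗ[ℂ] SExterior S where
  toFun := ccomm B a b u
  map_add' v w := by simp only [ccomm, cmul_add, add_cmul]; module
  map_smul' c v := by
    simp only [ccomm, cmul_smul, smul_cmul, RingHom.id_apply]; module

theorem ccommRight_apply (B : SuperForm S) (a b : ZMod 2) (u v : SExterior S) :
    ccommRight B a b u v = ccomm B a b u v := rfl

/-- On $\Lambda^2_a$ the sign in `zeta_cmul_comm` is that of the supercommutator, so only the
contraction term is left. In particular $[u,\cdot]_C$ maps $V$ to $V$. -/
theorem ccomm_zeta (B : SuperForm S) {a b : ZMod 2} {u : SExterior S} (hu : u ∈ extPart S 2 a)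
    {y : V} (hy : y ∈ S.part b) :
    ccomm B a b u (zeta 0 y) = -((2 * sgn a b) • contr 0 B y u) := by
  have h := zeta_cmul_comm B hy u
  rw [theta_of_mem b hu, smul_cmul] at h
  rw [ccomm, h, smul_add, smul_smul, sgn_comm b a]
  simp only [even_two, Even.neg_pow, one_pow, one_mul, sgn_mul_self]
  module

theorem ccomm_ccomm (B : SuperForm S) (a b c : ZMod 2) (u v w : SExterior S) :
    ccomm B (a + b) c (ccomm B a b u v) w
      = ccomm B a (b + c) u (ccomm B b c v w)
        - sgn a b • ccomm B b (a + c) v (ccomm B a c u w) := by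
  simp only [ccomm, sub_cmul, cmul_sub, smul_cmul, cmul_smul, cmul_assoc, sgn_add_left,
    sgn_add_right, sgn_comm b a]
  rcases zmod2_cases a with rfl | rfl <;> rcases zmod2_cases b with rfl | rfl <;>
    rcases zmod2_cases c with rfl | rfl <;>
    simp only [sgn_zero_left, sgn_zero_right, sgn_one_one] <;> module

theorem exists_ccomm_zeta (B : SuperForm S) {a b : ZMod 2} {u : SExterior S}
    (hu : u ∈ extPart S 2 a) {y : V} (hy : y ∈ S.part b) :
    ∃ m ∈ S.part (a + b), zeta 0 m = ccomm B a b u (zeta 0 y) := by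
  rw [ccomm_zeta B hu hy]
  refine exists_zeta_eq (Submodule.neg_mem _ (Submodule.smul_mem _ _ ?_))
  rw [add_comm]
  exact contr_mem_extPart B hy hu

/-- In operator form, $[\mathrm{ad}\,u,\iota(y)]=\iota([u,y]_C)$. Differentiating $uv$ and $vu$ by
$\iota(y)$ produces terms with $\iota(y)u$, a multiple of $m=[u,y]_C$; these form a commutator of
$m$ with $v$, which is $2\iota(m)v$. -/
theorem contr_ccomm (B : SuperForm S) {a b c : ZMod 2} {n : ℕ} {u v : SExterior S}
    (hu : u ∈ extPart S 2 a) (hv : v ∈ extPart S n c) {y m : V} (hy : y ∈ S.part b)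
    (hm : m ∈ S.part (a + b)) (h : zeta 0 m = ccomm B a b u (zeta 0 y)) :
    contr 0 B y (ccomm B a c u v)
      = sgn a b • (ccomm B a (b + c) u (contr 0 B y v) - contr 0 B m v) := by
  have h1 : contr 0 B y u = (-(1 / 2) * sgn a b) • zeta 0 m := by
    rw [h, ccomm_zeta B hu hy, smul_neg, smul_smul,
      show -(1 / 2) * sgn a b * (2 * sgn a b) = -(sgn a b * sgn a b) by ring, sgn_mul_self]
    module
  have h2 := zeta_cmul_comm B hm v
  have h3 : contr 0 B m v = (1 / 2 : ℂ) • (cmul B (zeta 0 m) v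
      - cmul B (theta 0 (a + b) v) (zeta 0 m)) := by rw [h2]; module
  rw [h3, ccomm, ccomm, map_sub, map_smul, contr_cmul B hy, contr_cmul B hy, h1,
    theta_of_mem b hu, theta_of_mem b hv, theta_of_mem (a + b) hv]
  simp only [smul_cmul, cmul_smul, sgn_add_left, sgn_add_right, sgn_comm b a, smul_sub, smul_add,
    smul_smul]
  have e : sgn a b * sgn a b = 1 := sgn_mul_self a b
  generalize sgn a b = s at e ⊢
  match_scalars <;> first | ring1 | linear_combination sgn a c * e

/-- The map $[u,\cdot]_C$ is a derivation of the Clifford product. Writing $y\wedge v=yv-\iota(y)v$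
and applying `contr_ccomm` to the last term shows that it is one of the exterior product too. -/
theorem ccomm_zeta_mul (B : SuperForm S) {a b c : ZMod 2} {n : ℕ} {u v : SExterior S}
    (hu : u ∈ extPart S 2 a) (hv : v ∈ extPart S n c) {y m : V} (hy : y ∈ S.part b)
    (hm : m ∈ S.part (a + b)) (h : zeta 0 m = ccomm B a b u (zeta 0 y)) :
    ccomm B a (b + c) u (zeta 0 y * v)
      = zeta 0 m * v + sgn a b • (zeta 0 y * ccomm B a c u v) := by
  have h1 := contr_ccomm B hu hv hy hm h
  have h2 : zeta 0 y * v = cmul B (zeta 0 y) v - contr 0 B y v := by rw [zeta_cmul]; module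
  have h3 : ccomm B a (b + c) u (cmul B (zeta 0 y) v)
      = cmul B (zeta 0 m) v + sgn a b • cmul B (zeta 0 y) (ccomm B a c u v) := by
    rw [h]
    simp only [ccomm, sub_cmul, cmul_sub, smul_cmul, cmul_smul, cmul_assoc, sgn_add_right]
    module
  rw [h2, ← ccommRight_apply, map_sub, ccommRight_apply, ccommRight_apply, h3, zeta_cmul,
    zeta_cmul, h1, smul_add, smul_smul, sgn_mul_self]
  module

/-- A derivation of the exterior product that maps $V$ to itself preserves the degree. -/
theorem ccomm_mem_extPart (B : SuperForm S) {a c : ZMod 2} {n : ℕ} {u v : SExterior S}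
    (hu : u ∈ extPart S 2 a) (hv : v ∈ extPart S n c) :
    ccomm B a c u v ∈ extPart S n (a + c) := by
  suffices extPart S n c ≤ (extPart S n (a + c)).comap (ccommRight B a c u) from this hv
  clear hv v
  induction n generalizing c with
  | zero =>
    refine Submodule.span_le.2 ?_
    rintro _ ⟨d, x, -, hd, rfl⟩
    obtain rfl : c = 0 := by simpa using hd.symm
    have h1 : (eta B).symm 1 = 1 := by rw [LinearEquiv.symm_apply_eq, eta_one]
    have h0 : ccommRight B a 0 u 1 = 0 := by
      simp [ccommRight_apply, ccomm, cmul, h1, sgn_zero_right]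
    simp [h0]
  | succ n ih =>
    refine extPart_succ_le _ fun b d y v hy hv hbd => ?_
    obtain ⟨m, hm, h⟩ := exists_ccomm_zeta B hu hy
    subst hbd
    rw [Submodule.mem_comap, ccommRight_apply, ccomm_zeta_mul B hu hv hy hm h]
    refine Submodule.add_mem _ ?_ (Submodule.smul_mem _ _ ?_)
    · rw [← add_assoc]; exact zeta_mul_mem_extPart hm hv
    · rw [add_left_comm]; exact zeta_mul_mem_extPart hy (ih hv)

/-! ### The brackets of cubic elements -/

theorem cubicBracket_mem (B : SuperForm S) {φ : SExterior S} (hφ : φ ∈ extPart S 3 0)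
    {a b : ZMod 2} {x y : V} (hx : x ∈ S.part a) (hy : y ∈ S.part b) :
    cubicBracket B φ x y ∈ S.part (a + b) := by
  refine mem_part_of_zeta_mem ?_
  rw [zeta_cubicBracket B hφ]
  have := contr_mem_extPart B hx (contr_mem_extPart B hy hφ)
  rw [add_zero] at this
  exact Submodule.smul_mem _ _ this

theorem contr_skew (B : SuperForm S) {a b : ZMod 2} {x y : V} (hx : x ∈ S.part a)
    (hy : y ∈ S.part b) (u : SExterior S) :
    contr 0 B x (contr 0 B y u) = -(sgn a b • contr 0 B y (contr 0 B x u)) :=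
  eq_neg_of_add_eq_zero_left (contr_contr 0 B B hx hy u)

theorem cubicBracket_skew (B : SuperForm S) {φ : SExterior S} (hφ : φ ∈ extPart S 3 0)
    {a b : ZMod 2} {x y : V} (hx : x ∈ S.part a) (hy : y ∈ S.part b) :
    cubicBracket B φ x y = -(sgn a b • cubicBracket B φ y x) := by
  refine zeta_injective S ?_
  rw [map_neg, map_smul, zeta_cubicBracket B hφ, zeta_cubicBracket B hφ, iotaExt,
    contr_skew B hx hy]
  module

theorem form_cubicBracket (B : SuperForm S) {φ : SExterior S} (hφ : φ ∈ extPart S 3 0)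
    {a b c : ZMod 2} {x y z : V} (hx : x ∈ S.part a) (hy : y ∈ S.part b) (hz : z ∈ S.part c) :
    B.form x (cubicBracket B φ y z) • (1 : SExterior S)
      = (2 : ℂ) • contr 0 B x (contr 0 B y (contr 0 B z φ)) := by
  rw [← contr_zeta 0 B hx (cubicBracket_mem B hφ hy hz), zeta_cubicBracket B hφ, map_smul]
  rfl

theorem super_ext₃ {W : Type*} [AddCommGroup W] [Module ℂ W] {f g : V →ₗ[ℂ] V →ₗ[ℂ] V →ₗ[ℂ] W}
    (S : SuperSpace V)
    (h : ∀ (a b c : ZMod 2) (x y z : V), x ∈ S.part a → y ∈ S.part b → z ∈ S.part c →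
      f x y z = g x y z) : f = g :=
  super_ext S fun a x hx => super_ext S fun b y hy => super_ext S fun c z hz =>
    h a b c x y z hx hy hz

/-- Both sides are triple contractions of $\phi$. Moving $\iota(z)$ past $\iota(x)$ and $\iota(y)$
produces the sign that super-symmetry of the form cancels. -/
theorem cubicBracket_invariant (B : SuperForm S) {φ : SExterior S} (hφ : φ ∈ extPart S 3 0)
    (x y z : V) :
    B.form (cubicBracket B φ x y) z = B.form x (cubicBracket B φ y z) := by
  set K := cubicBracket B φ with hK
  have h := super_ext₃ (f := (LinearMap.compr₂ K B.form)) (g :=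
    ((LinearMap.lcomp ℂ (V →ₗ[ℂ] ℂ) K) ∘ₗ (LinearMap.llcomp ℂ V V ℂ ∘ₗ B.form))) S ?_
  · exact DFunLike.congr_fun (LinearMap.congr_fun₂ h x y) z
  · intro a b c x y z hx hy hz
    refine scalar_injective S ?_
    change B.form (K x y) z • (1 : SExterior S) = B.form x (K y z) • 1
    rw [B.supersymm _ _ _ _ (cubicBracket_mem B hφ hx hy) hz, mul_smul,
      form_cubicBracket B hφ hz hx hy, form_cubicBracket B hφ hx hy hz, contr_skew B hz hx,
      contr_skew B hz hy, map_neg, map_smul]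
    rw [sgn_add_left]
    simp only [smul_neg, neg_neg, smul_smul, sgn_comm c]
    congr 1
    linear_combination 2 * sgn b c * sgn b c * sgn_mul_self a c + 2 * sgn_mul_self b c

/-- The commutator of an element of degree 2 with a cubic element measures the failure of its
adjoint action to be a derivation of the bracket. -/
theorem contr_contr_ccomm (B : SuperForm S) {a : ZMod 2} {u φ : SExterior S}
    (hu : u ∈ extPart S 2 a) (hφ : φ ∈ extPart S 3 0) {b c : ZMod 2} {s t s' t' w : V}
    (hs : s ∈ S.part b) (ht : t ∈ S.part c)
    (hs' : s' ∈ S.part (a + b)) (es : zeta 0 s' = ccomm B a b u (zeta 0 s))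
    (ht' : t' ∈ S.part (a + c)) (et : zeta 0 t' = ccomm B a c u (zeta 0 t))
    (ew : zeta 0 w = ccomm B a (b + c) u (zeta 0 (cubicBracket B φ s t))) :
    (2 : ℂ) • contr 0 B s (contr 0 B t (ccomm B a 0 u φ)) = (sgn a b * sgn a c) •
      zeta 0 (w - cubicBracket B φ s' t - sgn a b • cubicBracket B φ s t') := by
  have h1 := contr_mem_extPart B ht hφ
  -- Moving $\iota(t)$ and then $\iota(s)$ through $[u,\cdot]_C$ leaves the correction terms
  -- $\iota(t')$ and $\iota(s')$, the last two brackets of the claim.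
  rw [contr_ccomm B hu hφ ht ht' et, map_smul, map_sub, contr_ccomm B hu h1 hs hs' es]
  rw [zeta_cubicBracket B hφ, ← ccommRight_apply, map_smul, ccommRight_apply] at ew
  rw [map_sub, map_sub, map_smul, zeta_cubicBracket B hφ, zeta_cubicBracket B hφ, ew, add_zero]
  simp only [iotaExt]
  have e := sgn_mul_self a b
  generalize sgn a b = s at e ⊢
  match_scalars
  · ring
  · ring
  · linear_combination 2 * sgn a c * e

end commutator
-- The correspondence between invariant brackets and cubic elements
section existence
variable {V : Type*} [AddCommGroup V] [Module ℂ V] {S : SuperSpace V}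

theorem ccomm_sub_left (B : SuperForm S) (a b : ZMod 2) (u u' v : SExterior S) :
    ccomm B a b (u - u') v = ccomm B a b u v - ccomm B a b u' v := by
  simp only [ccomm, sub_cmul, cmul_sub]; module

theorem IsCubicElement.cubicBracket_eq {B : SuperForm S} {K : V →ₗ[ℂ] V →ₗ[ℂ] V}
    {φ : SExterior S} (h : IsCubicElement B K φ) : cubicBracket B φ = K := by
  refine LinearMap.ext₂ fun x y => zeta_injective S ?_
  rw [zeta_cubicBracket B h.1, h.2]

variable [FiniteDimensional ℂ V]

/-- A cubic element is determined by its bracket. -/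
theorem cubic_ext {B : SuperForm S} (hB : B.form.Nondegenerate) {a : ZMod 2} {u v : SExterior S}
    (hu : u ∈ extPart S 3 a) (hv : v ∈ extPart S 3 a)
    (h : ∀ (b c : ZMod 2) (s t : V), s ∈ S.part b → t ∈ S.part c →
      contr 0 B s (contr 0 B t u) = contr 0 B s (contr 0 B t v)) : u = v := by
  have hd := Submodule.sub_mem _ hu hv
  refine sub_eq_zero.1 (eq_zero_of_contr hB hd fun c t ht => ?_)
  refine eq_zero_of_contr hB (contr_mem_extPart B ht hd) fun b s hs => ?_
  rw [map_sub, map_sub, h b c s t hs ht, sub_self]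

/-- On vectors the commutator with a degree-two element is, up to a non-zero factor, a contraction,
and contractions detect elements of positive degree. -/
theorem quadratic_ext {B : SuperForm S} (hB : B.form.Nondegenerate) {a : ZMod 2}
    {u v : SExterior S} (hu : u ∈ extPart S 2 a) (hv : v ∈ extPart S 2 a)
    (h : ∀ (b : ZMod 2) (y : V), y ∈ S.part b →
      ccomm B a b u (zeta 0 y) = ccomm B a b v (zeta 0 y)) : u = v := by
  have hd := Submodule.sub_mem _ hu hv
  refine sub_eq_zero.1 (eq_zero_of_contr hB hd fun b y hy => ?_)
  have h1 := ccomm_zeta B hd hy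
  rw [ccomm_sub_left, h b y hy, sub_self, eq_comm, neg_eq_zero, smul_eq_zero] at h1
  refine h1.resolve_left (mul_ne_zero two_ne_zero fun h0 => ?_)
  simpa [h0] using sgn_mul_self a b

/-- An even super-skew-symmetric invariant bracket comes from a cubic element. -/
theorem exists_cubic {B : SuperForm S} (hB : B.form.Nondegenerate) (K : V →ₗ[ℂ] V →ₗ[ℂ] V)
    (heven : ∀ (a b : ZMod 2) (x y : V), x ∈ S.part a → y ∈ S.part b → K x y ∈ S.part (a + b))
    (hskew : ∀ (a b : ZMod 2) (x y : V), x ∈ S.part a → y ∈ S.part b →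
      K x y = -(sgn a b • K y x))
    (hinv : ∀ (a b c : ZMod 2) (x y z : V), x ∈ S.part a → y ∈ S.part b → z ∈ S.part c →
      B.form (K x y) z = B.form x (K y z)) :
    ∃ φ, IsCubicElement B K φ := by
  obtain ⟨n, d, e, e', h⟩ := exists_homogDualSystem B hB
  -- This is the desired $\iota(x)\iota(y)\phi$; the $1/2$ offsets the factor in
  -- $[x,y]=2\iota(x)\iota(y)\phi$. Integrating over $x$ gives $G(y)=\iota(y)\phi$, and integrating
  -- $G$ gives $\phi$.
  let f : V →ₗ[ℂ] V →ₗ[ℂ] SExterior S := (1 / 2 : ℂ) • K.flip.compr₂ (zeta 0)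
  have hf : ∀ x y, f y x = (1 / 2 : ℂ) • zeta 0 (K x y) := fun _ _ => rfl
  have hfmem : ∀ (b : ZMod 2) (y : V), y ∈ S.part b → ∀ (c : ZMod 2) (x : V), x ∈ S.part c →
      f y x ∈ extPart S 1 (c + b) := fun b y hy c x hx =>
    Submodule.smul_mem _ _ (zeta_mem_extPart (heven _ _ _ _ hx hy))
  let G : V →ₗ[ℂ] SExterior S := primitive e e' 1 ∘ₗ f
  have hG : ∀ (b c : ZMod 2) (x y : V), x ∈ S.part b → y ∈ S.part c →
      contr 0 B x (G y) = (1 / 2 : ℂ) • zeta 0 (K x y) := by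
    intro b c x y hx hy
    -- Closedness in $x$: by invariance $(x,K(z,y))=(K(x,z),y)$, which is super-skew in $x$ and $z$.
    refine h.contr_primitive (hfmem c y hy) (fun b b' x z hx hz => ?_) hx
    rw [hf, hf, map_smul, map_smul, contr_zeta 0 B hx (heven _ _ _ _ hz hy),
      contr_zeta 0 B hz (heven _ _ _ _ hx hy), ← hinv b b' c x z y hx hz hy,
      ← hinv b' b c z x y hz hx hy, hskew b b' x z hx hz]
    simp only [map_neg, map_smul, LinearMap.neg_apply, LinearMap.smul_apply, smul_eq_mul]
    module
  have hGmem : ∀ (b : ZMod 2) (y : V), y ∈ S.part b → G y ∈ extPart S 2 (b + 0) := by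
    intro b y hy
    rw [add_zero]
    exact h.primitive_mem (hfmem b y hy)
  refine ⟨primitive e e' 2 G, h.primitive_mem hGmem, fun x y => ?_⟩
  have key : K.compr₂ (zeta 0) = (2 : ℂ) •
      (iotaExt B).compl₁₂ LinearMap.id ((iotaExt B).flip (primitive e e' 2 G)) := by
    refine super_ext S fun a x hx => super_ext S fun b y hy => ?_
    have h1 : contr 0 B y (primitive e e' 2 G) = G y := by
      -- Closedness of $G$ is the super-skewness of $K$ itself.
      refine h.contr_primitive hGmem (fun b c y z hy hz => ?_) hy
      rw [hG _ _ _ _ hy hz, hG _ _ _ _ hz hy, hskew _ _ _ _ hy hz, map_neg, map_smul]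
      module
    have h2 : contr 0 B x (contr 0 B y (primitive e e' 2 G)) = (1 / 2 : ℂ) • zeta 0 (K x y) := by
      rw [h1, hG _ _ _ _ hx hy]
    change zeta 0 (K x y) = (2 : ℂ) • contr 0 B x (contr 0 B y (primitive e e' 2 G))
    rw [h2]
    module
  exact LinearMap.congr_fun₂ key x y

theorem IsCubicElement.unique {B : SuperForm S} (hB : B.form.Nondegenerate)
    {K : V →ₗ[ℂ] V →ₗ[ℂ] V} {φ φ' : SExterior S} (h : IsCubicElement B K φ)
    (h' : IsCubicElement B K φ') : φ = φ' := by
  refine cubic_ext hB h.1 h'.1 fun b c s t _ _ => ?_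
  have := (h.2 s t).symm.trans (h'.2 s t)
  exact (smul_right_injective _ (two_ne_zero' ℂ)) this

end existence

/-! ### The lift of the representation to degree-two elements -/

section nuStar
variable {r p : Type*} [AddCommGroup r] [Module ℂ r] [AddCommGroup p] [Module ℂ p]
  {R : SuperSpace r} {P : SuperSpace p} {br : r →ₗ[ℂ] r →ₗ[ℂ] r} {Bp : SuperForm P}
  {ν : r →ₗ[ℂ] Module.End ℂ p}

theorem IsNuStar.contr_eq {νs : r →ₗ[ℂ] SExterior P} (h : IsNuStar R br Bp ν νs)
    {a b : ZMod 2} {x : r} {y : p} (hx : x ∈ R.part a) (hy : y ∈ P.part b) :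
    contr 0 Bp y (νs x) = -((1 / 2 * sgn a b) • zeta 0 (ν x y)) := by
  rw [← h.ccomm_eq a b x y hx hy, ccomm_zeta Bp (h.mem a x hx) hy, smul_neg, smul_smul, neg_neg,
    show 1 / 2 * sgn a b * (2 * sgn a b) = sgn a b * sgn a b by ring, sgn_mul_self, one_smul]

variable [FiniteDimensional ℂ p]

theorem IsNuStar.unique (hBp : Bp.form.Nondegenerate) {νs νs' : r →ₗ[ℂ] SExterior P}
    (h : IsNuStar R br Bp ν νs) (h' : IsNuStar R br Bp ν νs') : νs = νs' :=
  super_ext R fun a x hx => quadratic_ext hBp (h.mem a x hx) (h'.mem a x hx) fun b y hy => by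
    rw [h.ccomm_eq a b x y hx hy, h'.ccomm_eq a b x y hx hy]

/-- By `ccomm_zeta` the lift must satisfy $\iota(y)\nu_*(x)=-\frac12(-1)^{|x||y|}\nu(x)y$. The
$\mathfrak{osp}$ condition makes the right-hand side closed in $y$, so it integrates. The
homomorphism property is then tested on vectors, where it is that of $\nu$. -/
theorem exists_isNuStar (hbr : ∀ (a b : ZMod 2) (x y : r), x ∈ R.part a → y ∈ R.part b →
      br x y ∈ R.part (a + b)) (hBp : Bp.form.Nondegenerate) (hν : IsOspRep R br Bp ν) :
    ∃ νs, IsNuStar R br Bp ν νs := by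
  obtain ⟨n, d, e, e', h⟩ := exists_homogDualSystem Bp hBp
  -- The projections and twists insert the sign $(-1)^{|x||y|}$ while keeping `F` bilinear on all
  -- vectors.
  let F : r →ₗ[ℂ] p →ₗ[ℂ] SExterior P := LinearMap.mk₂ ℂ
    (fun x y => -((1 / 2 : ℂ) • zeta 0 (ν (R.pr 0 x) (P.twist 0 y) + ν (R.pr 1 x) (P.twist 1 y))))
    (by intro x x' y; simp only [map_add, LinearMap.add_apply]; module)
    (by intro c x y; simp only [map_add, map_smul, LinearMap.smul_apply]; module)
    (by intro x y y'; simp only [map_add]; module)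
    (by intro c x y; simp only [map_add, map_smul]; module)
  have hF : ∀ (a b : ZMod 2) (x : r) (y : p), x ∈ R.part a → y ∈ P.part b →
      F x y = -((1 / 2 * sgn a b) • zeta 0 (ν x y)) := by
    intro a b x y hx hy
    change -((1 / 2 : ℂ) • zeta 0 (ν (R.pr 0 x) (P.twist 0 y) + ν (R.pr 1 x) (P.twist 1 y))) = _
    rw [P.twist_apply hy, P.twist_apply hy]
    rcases zmod2_cases a with rfl | rfl
    · rw [R.pr_same hx, R.pr_ne hx (by decide)]
      simp [smul_smul]
    · rw [R.pr_same hx, R.pr_ne hx (by decide)]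
      simp [smul_smul]
  have hFmem : ∀ (a : ZMod 2) (x : r), x ∈ R.part a → ∀ (b : ZMod 2) (y : p), y ∈ P.part b →
      F x y ∈ extPart P 1 (b + a) := by
    intro a x hx b y hy
    rw [hF a b x y hx hy, add_comm]
    exact Submodule.neg_mem _ (Submodule.smul_mem _ _ (zeta_mem_extPart (hν.even _ _ _ _ hx hy)))
  have hmem : ∀ (a : ZMod 2) (x : r), x ∈ R.part a →
      (primitive e e' 1 ∘ₗ F) x ∈ extPart P 2 a := fun a x hx => h.primitive_mem (hFmem a x hx)
  have hcomm : ∀ (a b : ZMod 2) (x : r) (y : p), x ∈ R.part a → y ∈ P.part b →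
      ccomm Bp a b ((primitive e e' 1 ∘ₗ F) x) (zeta 0 y) = zeta 0 (ν x y) := by
    intro a b x y hx hy
    have h1 : contr 0 Bp y ((primitive e e' 1 ∘ₗ F) x) = F x y := by
      refine h.contr_primitive (hFmem a x hx) (fun b c y z hy hz => ?_) hy
      have hyx := hν.even a b x y hx hy
      have hzx := hν.even a c x z hx hz
      rw [hF _ _ _ _ hx hz, hF _ _ _ _ hx hy, map_neg, map_neg, map_smul, map_smul,
        contr_zeta 0 Bp hy hzx, contr_zeta 0 Bp hz hyx, Bp.supersymm _ _ _ _ hz hyx,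
        eq_neg_of_add_eq_zero_left (hν.osp a b x y z hx hy)]
      rw [sgn_add_right, sgn_comm c b, sgn_comm c a]
      match_scalars
      linear_combination (1 / 2 * sgn a c * Bp.form y (ν x z)) *
        (sgn b c * sgn b c * sgn_mul_self a b + sgn_mul_self b c)
    rw [ccomm_zeta Bp (hmem a x hx) hy, h1, hF _ _ _ _ hx hy, smul_neg, neg_neg, smul_smul,
      show 2 * sgn a b * (1 / 2 * sgn a b) = sgn a b * sgn a b by ring, sgn_mul_self, one_smul]
  refine ⟨primitive e e' 1 ∘ₗ F, hmem, fun a b x x' hx hx' => ?_, hcomm⟩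
  refine quadratic_ext hBp (hmem _ _ (hbr _ _ _ _ hx hx'))
    (ccomm_mem_extPart Bp (hmem a x hx) (hmem b x' hx')) fun c y hy => ?_
  rw [hcomm _ _ _ _ (hbr _ _ _ _ hx hx') hy, ccomm_ccomm, hcomm _ _ _ _ hx hy,
    hcomm _ _ _ _ hx' hy, hcomm _ _ _ _ hx (hν.even _ _ _ _ hx' hy),
    hcomm _ _ _ _ hx' (hν.even _ _ _ _ hx hy), hν.map_bracket a b x x' hx hx']
  simp

variable {νs : r →ₗ[ℂ] SExterior P}

/-- This is `contr_contr_ccomm` for $u=\nu_*(x)$, whose commutator acts on $\mathfrak p$ as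
$\nu(x)$; double contractions detect the vanishing of a cubic element. -/
theorem IsNuStar.invariant_iff (h : IsNuStar R br Bp ν νs) (hBp : Bp.form.Nondegenerate)
    (hν : IsOspRep R br Bp ν) {φ : SExterior P} (hφ : φ ∈ extPart P 3 0) :
    (∀ (a : ZMod 2) (x : r), x ∈ R.part a → ccomm Bp a 0 (νs x) φ = 0) ↔
    ∀ (a b c : ZMod 2) (x : r) (s t : p), x ∈ R.part a → s ∈ P.part b → t ∈ P.part c →
      ν x (cubicBracket Bp φ s t) - cubicBracket Bp φ (ν x s) t
        - sgn a b • cubicBracket Bp φ s (ν x t) = 0 := by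
  have key : ∀ (a b c : ZMod 2) (x : r) (s t : p), x ∈ R.part a → s ∈ P.part b → t ∈ P.part c →
      (2 : ℂ) • contr 0 Bp s (contr 0 Bp t (ccomm Bp a 0 (νs x) φ)) = (sgn a b * sgn a c) •
        zeta 0 (ν x (cubicBracket Bp φ s t) - cubicBracket Bp φ (ν x s) t
        - sgn a b • cubicBracket Bp φ s (ν x t)) := fun a b c x s t hx hs ht =>
    contr_contr_ccomm Bp (h.mem a x hx) hφ hs ht (hν.even _ _ _ _ hx hs)
      (h.ccomm_eq _ _ _ _ hx hs).symm (hν.even _ _ _ _ hx ht) (h.ccomm_eq _ _ _ _ hx ht).symm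
      (h.ccomm_eq _ _ _ _ hx (cubicBracket_mem Bp hφ hs ht)).symm
  constructor
  · intro h0 a b c x s t hx hs ht
    have h1 := key a b c x s t hx hs ht
    rw [h0 a x hx, map_zero, map_zero, smul_zero, eq_comm, smul_eq_zero] at h1
    refine zeta_injective P ((h1.resolve_left fun h0 => ?_).trans (map_zero _).symm)
    have h2 := congrArg₂ (· * ·) (sgn_mul_self a b) (sgn_mul_self a c)
    have h3 : (sgn a b * sgn a c) * (sgn a b * sgn a c) = 1 := by
      simp only [mul_one] at h2; rw [← h2]; ring
    simp [h0] at h3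
  · intro h0 a x hx
    refine cubic_ext hBp (a := a) ?_ (Submodule.zero_mem _) fun b c s t hs ht => ?_
    · simpa using ccomm_mem_extPart Bp (h.mem a x hx) hφ
    · have h1 := key a b c x s t hx hs ht
      rw [h0 a b c x s t hx hs ht, map_zero, smul_zero] at h1
      simpa using h1

end nuStar
-- Contractions of the image of the Casimir element
section casimir
variable {r p : Type*} [AddCommGroup r] [Module ℂ r] [AddCommGroup p] [Module ℂ p]
  {R : SuperSpace r} {P : SuperSpace p} {br : r →ₗ[ℂ] r →ₗ[ℂ] r} {Br : SuperForm R}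
  {Bp : SuperForm P} {ν : r →ₗ[ℂ] Module.End ℂ p} {νs : r →ₗ[ℂ] SExterior P}

theorem eta_nuStarEnv_casimir (h : IsNuStar R br Bp ν νs) {ι : Type*} [Fintype ι] (x x' : ι → r) :
    eta Bp (nuStarEnv h (casimir R br x x')) = ∑ i, cmul Bp (νs (x i)) (νs (x' i)) := by
  have h1 : ∀ z, nuStarEnv h (envMap R br z) = (eta Bp).symm (νs z) := fun z => by
    have : nuStarEnv h (envMap R br z) = TensorAlgebra.lift ℂ
        ((eta Bp).symm.toLinearMap ∘ₗ νs) (TensorAlgebra.ι ℂ z) :=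
      RingQuot.liftAlgHom_mkAlgHom_apply ℂ _ _ (TensorAlgebra.ι ℂ z)
    rw [this, TensorAlgebra.lift_ι_apply]
    rfl
  simp only [casimir, map_sum, map_mul, h1]
  rfl

/-- The Clifford multiplication as a bilinear map. -/
noncomputable def cmulₗ (B : SuperForm P) : SExterior P →ₗ[ℂ] SExterior P →ₗ[ℂ] SExterior P :=
  LinearMap.mk₂ ℂ (cmul B) (add_cmul B) (smul_cmul B) (cmul_add B)
    (fun c u v => cmul_smul B c u v)

theorem cmulₗ_apply (B : SuperForm P) (u v : SExterior P) : cmulₗ B u v = cmul B u v := rfl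

theorem sgn_one_left_mul_sgn_self (a : ZMod 2) : sgn 1 a * sgn a a = 1 := by
  rcases zmod2_cases a with rfl | rfl <;> simp [sgn_zero_right, sgn_one_one]

variable {κ : Type*} [Fintype κ] {d : κ → ZMod 2} {e e' : κ → r}

/-- The derivation rule gives two sums, which contain the Clifford products of the vector
$\nu(e_i)y$ with $\nu_*(e'_i)$ in both orders. Their contraction parts cancel, so only exterior
products, of degree three, remain. -/
theorem contr_casimir (h : IsNuStar R br Bp ν νs) (hν : IsOspRep R br Bp ν)
    (he : IsHomogDualSystem Br d e e') {b : ZMod 2} {y : p} (hy : y ∈ P.part b) :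
    contr 0 Bp y (∑ i, cmul Bp (νs (e i)) (νs (e' i)))
      = -∑ i, sgn (d i) b • (zeta 0 (ν (e i) y) * νs (e' i)) := by
  have h1 : ∀ i, contr 0 Bp y (cmul Bp (νs (e i)) (νs (e' i)))
      = cmul Bp (contr 0 Bp y (νs (e i))) (νs (e' i))
        + cmul Bp (νs (R.twist b (e i))) (contr 0 Bp y (νs (e' i))) := fun i => by
    rw [contr_cmul Bp hy, theta_of_mem b (h.mem _ _ (he.mem i)), R.twist_apply (he.mem i), map_smul]
    simp
  -- Swapping the dual system makes the second sum contain contractions of $\nu_*(e_i)$, like the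
  -- first.
  have h2 := he.sum_swap ((cmulₗ Bp).compl₁₂ (νs ∘ₗ R.twist b) (contr 0 Bp y ∘ₗ νs))
  simp only [LinearMap.compl₁₂_apply, LinearMap.comp_apply, cmulₗ_apply] at h2
  rw [map_sum]
  simp only [h1]
  rw [Finset.sum_add_distrib, h2, ← Finset.sum_add_distrib, ← Finset.sum_neg_distrib]
  refine Finset.sum_congr rfl fun i _ => ?_
  have hm := hν.even _ _ _ _ (he.mem i) hy
  rw [R.twist_apply (he.mem' i), R.twist_apply (he.mem i), map_smul, map_smul, map_smul,
    h.contr_eq (he.mem i) hy]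
  have h4 : cmul Bp (νs (e' i)) (zeta 0 (ν (e i) y))
      = sgn (d i) (d i + b) • (zeta 0 (ν (e i) y) * νs (e' i)
        - contr 0 Bp (ν (e i) y) (νs (e' i))) := by
    have h6 := zeta_cmul_comm Bp hm (νs (e' i))
    rw [zeta_cmul, theta_of_mem _ (h.mem _ _ (he.mem' i)), smul_cmul, sgn_comm (d i + b)] at h6
    have e1 := sgn_mul_self (d i) (d i + b)
    generalize sgn (d i) (d i + b) = s at e1 h6 ⊢
    simp only [even_two, Even.neg_pow, one_pow, one_mul] at h6
    rw [← eq_sub_iff_add_eq'] at h6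
    rw [show zeta 0 (ν (e i) y) * νs (e' i) - contr 0 Bp (ν (e i) y) (νs (e' i))
      = s • cmul Bp (νs (e' i)) (zeta 0 (ν (e i) y)) by linear_combination (norm := module) h6,
      smul_smul, e1, one_smul]
  have h5 : cmul Bp (zeta 0 (ν (e i) y)) (νs (e' i)) = zeta 0 (ν (e i) y) * νs (e' i)
      + contr 0 Bp (ν (e i) y) (νs (e' i)) := zeta_cmul ..
  rw [← neg_smul, smul_cmul, smul_cmul, cmul_smul, cmul_smul, h4, h5, sgn_add_right, sgn_comm b]
  have e1 := sgn_one_left_mul_sgn_self (d i)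
  have e2 := sgn_mul_self (d i) b
  match_scalars
  · linear_combination (-(1 / 2) * sgn (d i) b) * (e1 + sgn 1 (d i) * sgn (d i) (d i) * e2)
  · linear_combination (1 / 2 * sgn (d i) b) * (e1 + sgn 1 (d i) * sgn (d i) (d i) * e2)

variable {β : p →ₗ[ℂ] p →ₗ[ℂ] r}

theorem form_rep_eq_zero (hν : IsOspRep R br Bp ν) {a b c : ZMod 2} {x : r} {y z : p}
    (hx : x ∈ R.part a) (hy : y ∈ P.part b) (hz : z ∈ P.part c) (h : a + b ≠ c) :
    Bp.form (ν x y) z = 0 := Bp.consistent _ _ _ _ (hν.even _ _ _ _ hx hy) hz h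

/-- Two further contractions of $\nu(e_i)y\wedge\nu_*(e'_i)$ give vectors with coefficients such as
$(\nu(e'_i)s,t)=(e'_i,\beta(s,t))$. Summing over the dual system assembles each into a value of
$\nu\circ\beta$. -/
theorem contr_contr_contr_casimir (h : IsNuStar R br Bp ν νs) (hν : IsOspRep R br Bp ν)
    (he : IsHomogDualSystem Br d e e')
    (hβm : ∀ (a b : ZMod 2) (y z : p), y ∈ P.part a → z ∈ P.part b → β y z ∈ R.part (a + b))
    (hβ : ∀ (x : r) (y z : p), Br.form x (β y z) = Bp.form (ν x y) z)
    {a b c : ZMod 2} {y s t : p} (hy : y ∈ P.part a) (hs : s ∈ P.part b) (ht : t ∈ P.part c) :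
    (2 : ℂ) • contr 0 Bp s (contr 0 Bp t (contr 0 Bp y
      (∑ i, cmul Bp (νs (e i)) (νs (e' i))))) = zeta 0 (-ν (β s t) y
        - (sgn a b * sgn a c) • ν (β y s) t
        + (sgn a b * sgn a c * sgn b c) • ν (β y t) s) := by
  have hL : ∀ (F : r →ₗ[ℂ] p), ∑ i, Bp.form (ν (e' i) s) t • F (e i) = F (β s t) := fun F => by
    simp only [← hβ]
    exact he.sum_left_map F (β s t)
  have hR : ∀ (F : r →ₗ[ℂ] p) (g : ZMod 2) (w : p), w ∈ P.part g →
      ∑ i, Bp.form (ν (e i) y) w • F (e' i) = sgn 1 (a + g) • F (β y w) := fun F g w hw => by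
    simp only [← hβ, form_twist Br _ (β y w)]
    rw [he.sum_right_map F, R.twist_apply (hβm _ _ _ _ hy hw), map_smul]
  rw [contr_casimir h hν he hy]
  have key : ∀ i, (2 : ℂ) • contr 0 Bp s (contr 0 Bp t
      (sgn (d i) a • (zeta 0 (ν (e i) y) * νs (e' i)))) = zeta 0 (
        Bp.form (ν (e' i) s) t • ν (e i) y
        + (sgn a b * sgn a c * sgn 1 (a + b)) • Bp.form (ν (e i) y) s • ν (e' i) t
        - (sgn a b * sgn a c * sgn b c * sgn 1 (a + c)) •
          Bp.form (ν (e i) y) t • ν (e' i) s) := by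
    intro i
    have hm := hν.even _ _ _ _ (he.mem i) hy
    have hn := hν.even _ _ _ _ (he.mem' i) ht
    have f1 := Bp.supersymm _ _ _ _ ht hm
    have f2 := Bp.supersymm _ _ _ _ hs hm
    have f3 : Bp.form s (ν (e' i) t) = -(sgn (d i) b * Bp.form (ν (e' i) s) t) := by
      linear_combination sgn (d i) b * hν.osp _ _ _ _ t (he.mem' i) hs
        - Bp.form s (ν (e' i) t) * sgn_mul_self (d i) b
    have z1 := form_rep_eq_zero hν (he.mem i) hy hs
    have z2 := form_rep_eq_zero hν (he.mem i) hy ht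
    have z3 := form_rep_eq_zero hν (he.mem' i) hs ht
    rw [map_smul, map_smul, contr_zeta_mul 0 Bp ht hm, h.contr_eq (he.mem' i) ht, map_sub,
      map_smul, map_smul, h.contr_eq (he.mem' i) hs, mul_neg, mul_smul_comm, map_neg, map_smul,
      contr_zeta_mul 0 Bp hs hm, contr_zeta 0 Bp hs hn, f1, f2, f3]
    simp only [map_add, map_sub, map_smul, mul_smul_comm, mul_one]
    generalize Bp.form (ν (e i) y) s = α₁ at *
    generalize Bp.form (ν (e i) y) t = α₂ at *
    generalize Bp.form (ν (e' i) s) t = α₃ at *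
    clear f1 f2 f3
    generalize d i = δ at *
    clear hL hR hm hn
    -- A sign check over the sixteen parities of $y,s,t,e_i$; the facts `z1`, `z2`, `z3` remove the
    -- coefficients that vanish by consistency.
    rcases zmod2_cases a with rfl | rfl <;> rcases zmod2_cases b with rfl | rfl <;>
      rcases zmod2_cases c with rfl | rfl <;> rcases zmod2_cases δ with rfl | rfl <;>
      simp only [sgn_zero_left, sgn_zero_right, sgn_one_one, zmod2_one_add_one, add_zero, zero_add,
        ne_eq, one_ne_zero, zero_ne_one, not_true_eq_false, not_false_eq_true, forall_const,
        false_implies, one_mul, neg_mul] at z1 z2 z3 ⊢ <;> subst_vars <;>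
      module
  rw [map_neg, map_neg, smul_neg, map_sum, map_sum, Finset.smul_sum]
  simp only [key]
  rw [← map_sum, Finset.sum_sub_distrib, Finset.sum_add_distrib]
  have s1 := hL (ν.flip y)
  have s2 := hR (ν.flip t) b s hs
  have s3 := hR (ν.flip s) c t ht
  simp only [LinearMap.flip_apply] at s1 s2 s3
  rw [← Finset.smul_sum, ← Finset.smul_sum, s1, s2, s3, ← map_neg]
  simp only [smul_smul]
  congr 1
  have e1 := sgn_mul_self 1 (a + b)
  have e2 := sgn_mul_self 1 (a + c)
  match_scalars
  · ring
  · linear_combination -(sgn a b * sgn a c) * e1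
  · linear_combination sgn a b * sgn a c * sgn b c * e2

end casimir
-- The constancy condition as an identity for the bracket on `p`
section constancy
variable {r p : Type*} [AddCommGroup r] [Module ℂ r] [AddCommGroup p] [Module ℂ p]
  {R : SuperSpace r} {P : SuperSpace p} {br : r →ₗ[ℂ] r →ₗ[ℂ] r} {Br : SuperForm R}
  {Bp : SuperForm P} {ν : r →ₗ[ℂ] Module.End ℂ p} {νs : r →ₗ[ℂ] SExterior P}
  {β : p →ₗ[ℂ] p →ₗ[ℂ] r}

/-- As $\phi$ has odd degree and even parity, $\iota(y)$ passes it with the sign $-1$, which turns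
the derivation rule into a commutator. -/
theorem contr_cmul_self {φ : SExterior P} (hφ : φ ∈ extPart P 3 0) {a : ZMod 2} {y : p}
    (hy : y ∈ P.part a) :
    contr 0 Bp y (cmul Bp φ φ) = ccomm Bp a 0 (contr 0 Bp y φ) φ := by
  rw [contr_cmul Bp hy, theta_of_mem a hφ, smul_cmul, ccomm, sgn_zero_right]
  module

/-- The commutator with $\iota(y)\phi\in\Lambda^2$ acts on vectors as $[y,\cdot]^\phi$, so its
failure to be a derivation is the Jacobiator. -/
theorem contr_contr_contr_cmul_self {φ : SExterior P} (hφ : φ ∈ extPart P 3 0)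
    {a b c : ZMod 2} {y s t : p} (hy : y ∈ P.part a) (hs : s ∈ P.part b) (ht : t ∈ P.part c) :
    (2 : ℂ) • contr 0 Bp s (contr 0 Bp t (contr 0 Bp y (cmul Bp φ φ)))
      = (sgn a b * sgn a c) • zeta 0 (cubicBracket Bp φ y (cubicBracket Bp φ s t)
        - cubicBracket Bp φ (cubicBracket Bp φ y s) t
        - sgn a b • cubicBracket Bp φ s (cubicBracket Bp φ y t)) := by
  have hu : contr 0 Bp y φ ∈ extPart P 2 a := by simpa using contr_mem_extPart Bp hy hφ
  have hD : ∀ (b : ZMod 2) (z : p), z ∈ P.part b → zeta 0 (cubicBracket Bp φ y z)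
      = ccomm Bp a b (contr 0 Bp y φ) (zeta 0 z) := fun b z hz => by
    rw [ccomm_zeta Bp hu hz, zeta_cubicBracket Bp hφ, iotaExt, contr_skew Bp hy hz]
    module
  rw [contr_cmul_self hφ hy]
  exact contr_contr_ccomm Bp hu hφ hs ht (cubicBracket_mem Bp hφ hy hs) (hD _ _ hs)
    (cubicBracket_mem Bp hφ hy ht) (hD _ _ ht) (hD _ _ (cubicBracket_mem Bp hφ hs ht))

/-- The left side of the identity is, up to a sign and the factor 2, the triple contraction of
$\nu_*(\mathrm{Cas}_{\mathfrak r})+\phi^2$. An element is a scalar exactly when its contractions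
vanish. -/
theorem constancy_iff [FiniteDimensional ℂ r] [FiniteDimensional ℂ p]
    (h : IsNuStar R br Bp ν νs) (hν : IsOspRep R br Bp ν)
    (hBr : Br.form.Nondegenerate) (hBp : Bp.form.Nondegenerate)
    (hβm : ∀ (a b : ZMod 2) (y z : p), y ∈ P.part a → z ∈ P.part b → β y z ∈ R.part (a + b))
    (hβ : ∀ (x : r) (y z : p), Br.form x (β y z) = Bp.form (ν x y) z)
    {ι : Type*} [Fintype ι] {x x' : ι → r} (hx : IsDualSystem Br x x')
    {φ : SExterior P} (hφ : φ ∈ extPart P 3 0) :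
    (∃ c : ℂ, eta Bp (nuStarEnv h (casimir R br x x')) + cmul Bp φ φ
      = algebraMap ℂ (SExterior P) c) ↔
    ∀ (a b c : ZMod 2) (y s t : p), y ∈ P.part a → s ∈ P.part b → t ∈ P.part c →
      cubicBracket Bp φ y (cubicBracket Bp φ s t) - cubicBracket Bp φ (cubicBracket Bp φ y s) t
        - sgn a b • cubicBracket Bp φ s (cubicBracket Bp φ y t)
        - (sgn a b * sgn a c) • ν (β s t) y - ν (β y s) t + sgn b c • ν (β y t) s = 0 := by
  obtain ⟨n, d, e, e', he⟩ := exists_homogDualSystem Br hBr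
  have hcas := hx.sum_eq he.toIsDualSystem ((cmulₗ Bp).compl₁₂ νs νs)
  simp only [LinearMap.compl₁₂_apply, cmulₗ_apply] at hcas
  rw [eta_nuStarEnv_casimir, hcas]
  set w := ∑ i, cmul Bp (νs (e i)) (νs (e' i)) + cmul Bp φ φ with hw
  -- Each $\iota(y)w$ is purely of degree three, so two more contractions suffice to detect it.
  have hmem : ∀ (a : ZMod 2) (y : p), y ∈ P.part a → contr 0 Bp y w ∈ extPart P 3 a := by
    intro a y hy
    rw [hw, map_add, contr_casimir h hν he hy, contr_cmul_self hφ hy]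
    refine Submodule.add_mem _ (Submodule.neg_mem _ (Submodule.sum_mem _ fun i _ =>
      Submodule.smul_mem _ _ ?_)) ?_
    · have := zeta_mul_mem_extPart (hν.even _ _ _ _ (he.mem i) hy) (h.mem _ _ (he.mem' i))
      rwa [add_right_comm, CharTwo.add_self_eq_zero, zero_add] at this
    · have hu : contr 0 Bp y φ ∈ extPart P 2 a := by simpa using contr_mem_extPart Bp hy hφ
      simpa using ccomm_mem_extPart Bp hu hφ
  have key : ∀ (a b c : ZMod 2) (y s t : p), y ∈ P.part a → s ∈ P.part b → t ∈ P.part c →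
      (2 : ℂ) • contr 0 Bp s (contr 0 Bp t (contr 0 Bp y w)) = (sgn a b * sgn a c) • zeta 0
      (cubicBracket Bp φ y (cubicBracket Bp φ s t) - cubicBracket Bp φ (cubicBracket Bp φ y s) t
        - sgn a b • cubicBracket Bp φ s (cubicBracket Bp φ y t)
        - (sgn a b * sgn a c) • ν (β s t) y - ν (β y s) t + sgn b c • ν (β y t) s) := by
    intro a b c y s t hy hs ht
    have e1 := sgn_mul_self a b
    have e2 := sgn_mul_self a c
    rw [hw, map_add, map_add, map_add, smul_add,
      contr_contr_contr_casimir h hν he hβm hβ hy hs ht, contr_contr_contr_cmul_self hφ hy hs ht]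
    simp only [map_add, map_sub, map_neg, map_smul]
    match_scalars <;> first
      | ring1
      | linear_combination e1 + sgn a b * sgn a b * e2
  constructor
  · rintro ⟨k, hk⟩ a b c y s t hy hs ht
    have h1 := key a b c y s t hy hs ht
    rw [hk, Algebra.algebraMap_eq_smul_one, map_smul, contr_one, smul_zero, map_zero, map_zero,
      smul_zero, eq_comm, smul_eq_zero] at h1
    refine zeta_injective P ((h1.resolve_left (mul_ne_zero ?_ ?_)).trans (map_zero _).symm)
    · intro h0; simpa [h0] using sgn_mul_self a b
    · intro h0; simpa [h0] using sgn_mul_self a c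
  · intro h0
    refine eq_algebraMap_of_contr hBp fun a y hy => ?_
    refine cubic_ext hBp (hmem a y hy) (Submodule.zero_mem _) fun b c s t hs ht => ?_
    have h1 := key a b c y s t hy hs ht
    rw [h0 a b c y s t hy hs ht, map_zero, smul_zero] at h1
    simpa using h1

end constancy

/-! ### Invariant brackets on `r × p` and their Jacobi identity -/

section extension
variable {r p : Type*} [AddCommGroup r] [Module ℂ r] [AddCommGroup p] [Module ℂ p]
  {R : SuperSpace r} {P : SuperSpace p} {br : r →ₗ[ℂ] r →ₗ[ℂ] r} {Br : SuperForm R}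
  {Bp : SuperForm P} {ν : r →ₗ[ℂ] Module.End ℂ p} {bg bg' : (r × p) →ₗ[ℂ] (r × p) →ₗ[ℂ] (r × p)}

/-- The conditions on a bracket of Lie super type except for the Jacobi identity. -/
structure IsInvariantExtension (br : r →ₗ[ℂ] r →ₗ[ℂ] r) (Br : SuperForm R) (Bp : SuperForm P)
    (ν : r →ₗ[ℂ] Module.End ℂ p) (bg : (r × p) →ₗ[ℂ] (r × p) →ₗ[ℂ] (r × p)) : Prop where
  even : ∀ (a b : ZMod 2) (x y : r × p), x ∈ (R.prod P).part a → y ∈ (R.prod P).part b →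
    bg x y ∈ (R.prod P).part (a + b)
  skew : ∀ (a b : ZMod 2) (x y : r × p), x ∈ (R.prod P).part a → y ∈ (R.prod P).part b →
    bg x y = -(sgn a b • bg y x)
  invariant : ∀ x y z : r × p, (Br.prod Bp).form (bg x y) z = (Br.prod Bp).form x (bg y z)
  subalgebra : ∀ x x' : r, bg (x, 0) (x', 0) = (br x x', 0)
  action : ∀ (x : r) (y : p), bg (x, 0) (0, y) = (0, ν x y)

/-- The component `p × p → r` of a bracket on `r ⊕ p`. -/
def bracketFst (bg : (r × p) →ₗ[ℂ] (r × p) →ₗ[ℂ] (r × p)) : p →ₗ[ℂ] p →ₗ[ℂ] r :=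
  (bg.compl₁₂ (LinearMap.inr ℂ r p) (LinearMap.inr ℂ r p)).compr₂ (LinearMap.fst ℂ r p)

/-- The component `p × p → p` of a bracket on `r ⊕ p`. -/
def bracketSnd (bg : (r × p) →ₗ[ℂ] (r × p) →ₗ[ℂ] (r × p)) : p →ₗ[ℂ] p →ₗ[ℂ] p :=
  (bg.compl₁₂ (LinearMap.inr ℂ r p) (LinearMap.inr ℂ r p)).compr₂ (LinearMap.snd ℂ r p)

theorem bracket_inr_inr (bg : (r × p) →ₗ[ℂ] (r × p) →ₗ[ℂ] (r × p)) (y z : p) :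
    bg (0, y) (0, z) = (bracketFst bg y z, bracketSnd bg y z) := rfl

theorem prod_form_apply (x y : r × p) :
    (Br.prod Bp).form x y = Br.form x.1 y.1 + Bp.form x.2 y.2 := rfl

theorem inl_mem {a : ZMod 2} {x : r} (hx : x ∈ R.part a) : ((x, 0) : r × p) ∈ (R.prod P).part a :=
  ⟨hx, (P.part a).zero_mem⟩

theorem inr_mem {a : ZMod 2} {y : p} (hy : y ∈ P.part a) : ((0, y) : r × p) ∈ (R.prod P).part a :=
  ⟨(R.part a).zero_mem, hy⟩

namespace IsInvariantExtension

theorem form_bracketFst (h : IsInvariantExtension br Br Bp ν bg) (x : r) (y z : p) :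
    Br.form x (bracketFst bg y z) = Bp.form (ν x y) z := by
  have := h.invariant (x, 0) (0, y) (0, z)
  rw [h.action, bracket_inr_inr] at this
  simpa [prod_form_apply] using this.symm

theorem bracketFst_mem (h : IsInvariantExtension br Br Bp ν bg) (a b : ZMod 2) (y z : p)
    (hy : y ∈ P.part a) (hz : z ∈ P.part b) : bracketFst bg y z ∈ R.part (a + b) :=
  (h.even a b _ _ (inr_mem hy) (inr_mem hz)).1

theorem bracketSnd_mem (h : IsInvariantExtension br Br Bp ν bg) (a b : ZMod 2) (y z : p)
    (hy : y ∈ P.part a) (hz : z ∈ P.part b) : bracketSnd bg y z ∈ P.part (a + b) :=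
  (h.even a b _ _ (inr_mem hy) (inr_mem hz)).2

theorem bracketSnd_skew (h : IsInvariantExtension br Br Bp ν bg) (a b : ZMod 2) (y z : p)
    (hy : y ∈ P.part a) (hz : z ∈ P.part b) :
    bracketSnd bg y z = -(sgn a b • bracketSnd bg z y) :=
  congrArg Prod.snd (h.skew a b _ _ (inr_mem hy) (inr_mem hz))

theorem bracketSnd_invariant (h : IsInvariantExtension br Br Bp ν bg) (x y z : p) :
    Bp.form (bracketSnd bg x y) z = Bp.form x (bracketSnd bg y z) := by
  have := h.invariant (0, x) (0, y) (0, z)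
  rw [bracket_inr_inr, bracket_inr_inr] at this
  simpa [prod_form_apply] using this

theorem inr_inl (h : IsInvariantExtension br Br Bp ν bg) {a b : ZMod 2} {x : r} {y : p}
    (hx : x ∈ R.part a) (hy : y ∈ P.part b) :
    bg (0, y) (x, 0) = (0, -(sgn a b • ν x y)) := by
  rw [h.skew b a _ _ (inr_mem hy) (inl_mem hx), h.action, sgn_comm]
  ext <;> simp

/-- The component into $\mathfrak r$ is fixed by `form_bracketFst` and non-degeneracy, and the mixed
ones by $\nu$ and skewness; only the component $\mathfrak p\times\mathfrak p\to\mathfrak p$ is free.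
-/
theorem ext (hBr : Br.form.Nondegenerate) (h : IsInvariantExtension br Br Bp ν bg)
    (h' : IsInvariantExtension br Br Bp ν bg') (e : bracketSnd bg = bracketSnd bg') :
    bg = bg' := by
  have e' : bracketFst bg = bracketFst bg' := LinearMap.ext₂ fun y z =>
    sub_eq_zero.1 (hBr.2 _ fun x => by
      rw [map_sub, h.form_bracketFst, h'.form_bracketFst, sub_self])
  refine super_ext (R.prod P) fun a x hx => super_ext (R.prod P) fun b y hy => ?_
  have hx1 : x = (x.1, 0) + (0, x.2) := by simp
  have hy1 : y = (y.1, 0) + (0, y.2) := by simp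
  rw [hx1, hy1]
  simp only [map_add, LinearMap.add_apply, h.subalgebra, h'.subalgebra, h.action, h'.action,
    h.inr_inl hy.1 hx.2, h'.inr_inl hy.1 hx.2, bracket_inr_inr, e, e']

/-- The Jacobi identity for an invariant extension. -/
theorem jacobi_iff (hr : IsLieSuper R br) (hinv : ∀ x y z : r, Br.form (br x y) z
      = Br.form x (br y z)) (hν : IsOspRep R br Bp ν) (hBr : Br.form.Nondegenerate)
    (h : IsInvariantExtension br Br Bp ν bg) :
    (∀ (a b : ZMod 2) (x y z : r × p), x ∈ (R.prod P).part a → y ∈ (R.prod P).part b →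
      bg x (bg y z) = bg (bg x y) z + sgn a b • bg y (bg x z)) ↔
    (∀ (a b c : ZMod 2) (x : r) (s t : p), x ∈ R.part a → s ∈ P.part b → t ∈ P.part c →
      ν x (bracketSnd bg s t) - bracketSnd bg (ν x s) t - sgn a b • bracketSnd bg s (ν x t) = 0) ∧
    (∀ (a b c : ZMod 2) (y s t : p), y ∈ P.part a → s ∈ P.part b → t ∈ P.part c →
      bracketSnd bg y (bracketSnd bg s t) - bracketSnd bg (bracketSnd bg y s) t
        - sgn a b • bracketSnd bg s (bracketSnd bg y t)
        - (sgn a b * sgn a c) • ν (bracketFst bg s t) y - ν (bracketFst bg y s) t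
        + sgn b c • ν (bracketFst bg y t) s = 0) := by
  have inr_pair : ∀ (b c : ZMod 2) (y : p) (x : r) (z : p), y ∈ P.part b → x ∈ R.part c →
      bg (0, y) (x, z) = (bracketFst bg y z, bracketSnd bg y z - sgn c b • ν x y) := by
    intro b c y x z hy hx
    rw [show (x, z) = ((x, 0) : r × p) + (0, z) by simp, map_add, h.inr_inl hx hy, bracket_inr_inr]
    ext <;> simp; abel
  have inl_pair : ∀ (x x' : r) (z : p), bg (x, 0) (x', z) = (br x x', ν x z) := by
    intro x x' z
    rw [show (x', z) = ((x', 0) : r × p) + (0, z) by simp, map_add, h.subalgebra, h.action]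
    ext <;> simp
  have pair_inr : ∀ (x : r) (y z : p), bg (x, y) (0, z)
      = (bracketFst bg y z, ν x z + bracketSnd bg y z) := by
    intro x y z
    rw [show (x, y) = ((x, 0) : r × p) + (0, y) by simp, map_add, LinearMap.add_apply, h.action,
      bracket_inr_inr]
    ext <;> simp
  set β := bracketFst bg with hβ
  set K := bracketSnd bg with hK
  let J : ZMod 2 → ZMod 2 → (r × p) → (r × p) → (r × p) → (r × p) := fun a b x y z =>
    bg x (bg y z) - bg (bg x y) z - sgn a b • bg y (bg x z)
  -- The $\mathfrak r$-component vanishes automatically: paired with $w\in\mathfrak r$, it reduces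
  -- by invariance and the representation property to the $\mathfrak{osp}$ condition for $x$.
  have J_rpp : ∀ (a b c : ZMod 2) (x : r) (s t : p), x ∈ R.part a → s ∈ P.part b → t ∈ P.part c →
      J a b (x, 0) (0, s) (0, t)
        = (0, ν x (K s t) - K (ν x s) t - sgn a b • K s (ν x t)) := by
    intro a b c x s t hx hs ht
    have e1 : J a b (x, 0) (0, s) (0, t) = (br x (β s t) - β (ν x s) t - sgn a b • β s (ν x t),
        ν x (K s t) - K (ν x s) t - sgn a b • K s (ν x t)) := by
      simp only [J, bracket_inr_inr, h.action, inl_pair, ← hβ, ← hK]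
      ext <;> simp
    rw [e1]
    refine Prod.ext (hBr.2 _ fun w => ?_) rfl
    obtain ⟨w0, hw0, w1, hw1, rfl⟩ := R.exists_add w
    suffices ∀ (e : ZMod 2) (w : r), w ∈ R.part e →
        Br.form w (br x (β s t) - β (ν x s) t - sgn a b • β s (ν x t)) = 0 by
      rw [map_add, LinearMap.add_apply, this 0 w0 hw0, this 1 w1 hw1, add_zero]
    intro e w hw
    rw [map_sub, map_sub, map_smul, ← hinv, h.form_bracketFst, h.form_bracketFst,
      h.form_bracketFst, hν.map_bracket e a w x hw hx]
    have h1 := hν.osp a (e + b) x (ν w s) t hx (hν.even _ _ _ _ hw hs)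
    rw [sgn_add_right] at h1
    have e2 := sgn_mul_self a e
    simp only [LinearMap.sub_apply, LinearMap.smul_apply, Module.End.mul_apply, map_sub, map_smul,
      smul_eq_mul, sgn_comm e a]
    linear_combination (-sgn a e) * h1 + sgn a b * Bp.form (ν w s) (ν x t) * e2
  -- Here the $\mathfrak r$-component, paired with $w\in\mathfrak r$, is the derivation property of
  -- $\nu(w)$ paired with $t$, by invariance and skewness of $K$.
  have J_ppp : (∀ (a b c : ZMod 2) (x : r) (s t : p), x ∈ R.part a → s ∈ P.part b →
      t ∈ P.part c → ν x (K s t) - K (ν x s) t - sgn a b • K s (ν x t) = 0) →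
      ∀ (a b c : ZMod 2) (y s t : p), y ∈ P.part a → s ∈ P.part b → t ∈ P.part c →
      J a b (0, y) (0, s) (0, t) = (0, K y (K s t) - K (K y s) t - sgn a b • K s (K y t)
        - (sgn a b * sgn a c) • ν (β s t) y - ν (β y s) t + sgn b c • ν (β y t) s) := by
    intro hder a b c y s t hy hs ht
    have e1 : J a b (0, y) (0, s) (0, t) = (β y (K s t) - β (K y s) t - sgn a b • β s (K y t),
        K y (K s t) - K (K y s) t - sgn a b • K s (K y t)
        - (sgn a b * sgn a c) • ν (β s t) y - ν (β y s) t + sgn b c • ν (β y t) s) := by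
      have hst : β s t ∈ R.part (b + c) := h.bracketFst_mem _ _ _ _ hs ht
      have hyt : β y t ∈ R.part (a + c) := h.bracketFst_mem _ _ _ _ hy ht
      simp only [J, bracket_inr_inr, ← hβ, ← hK]
      rw [inr_pair _ _ _ _ _ hy hst, inr_pair _ _ _ _ _ hs hyt, pair_inr]
      simp only [Prod.mk_sub_mk, Prod.smul_mk, Prod.mk.injEq, true_and, sgn_add_left, sgn_comm c,
        sgn_comm b a, smul_sub,
        smul_smul]
      have e2 := sgn_mul_self a b
      match_scalars <;> first
        | ring1
        | linear_combination sgn b c * e2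
    rw [e1]
    refine Prod.ext (hBr.2 _ fun w => ?_) rfl
    obtain ⟨w0, hw0, w1, hw1, rfl⟩ := R.exists_add w
    suffices ∀ (e : ZMod 2) (w : r), w ∈ R.part e →
        Br.form w (β y (K s t) - β (K y s) t - sgn a b • β s (K y t)) = 0 by
      rw [map_add, LinearMap.add_apply, this 0 w0 hw0, this 1 w1 hw1, add_zero]
    intro e w hw
    have h1 := congrArg (fun v => Bp.form v t) (hder e a b w y s hw hy hs)
    have h2 := congrArg (fun v => Bp.form v t)
      (h.bracketSnd_skew _ _ _ _ (hν.even _ _ _ _ hw hs) hy)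
    simp only [← hK, map_sub, map_neg, map_smul, LinearMap.sub_apply, LinearMap.neg_apply,
      LinearMap.smul_apply, map_zero, LinearMap.zero_apply, smul_eq_mul, sgn_add_left] at h1 h2
    rw [map_sub, map_sub, map_smul, h.form_bracketFst, h.form_bracketFst,
      h.form_bracketFst, ← h.bracketSnd_invariant, ← h.bracketSnd_invariant, ← hK, smul_eq_mul, h2]
    have e2 := sgn_mul_self a b
    rw [sgn_comm b a]
    linear_combination -h1 + sgn e a * Bp.form (K y (ν w s)) t * e2
  constructor
  · intro hj
    have hJ : ∀ (a b : ZMod 2) (x y z : r × p), x ∈ (R.prod P).part a → y ∈ (R.prod P).part b →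
        J a b x y z = 0 := fun a b x y z hx hy => by
      simp only [J]; rw [hj a b x y z hx hy]; abel
    have hder : ∀ (a b c : ZMod 2) (x : r) (s t : p), x ∈ R.part a → s ∈ P.part b →
        t ∈ P.part c → ν x (K s t) - K (ν x s) t - sgn a b • K s (ν x t) = 0 :=
      fun a b c x s t hx hs ht => congrArg Prod.snd
        ((J_rpp a b c x s t hx hs ht).symm.trans (hJ a b _ _ _ (inl_mem hx) (inr_mem hs)))
    exact ⟨hder, fun a b c y s t hy hs ht => congrArg Prod.snd
      ((J_ppp hder a b c y s t hy hs ht).symm.trans (hJ a b _ _ _ (inr_mem hy) (inr_mem hs)))⟩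
  · rintro ⟨hder, hppp⟩
    -- The Jacobiator is super-skew in its arguments, so its vanishing need only be known for one
    -- order of each type $\mathfrak{rrr}$, $\mathfrak{rrp}$, $\mathfrak{rpp}$, $\mathfrak{ppp}$.
    have swap12 : ∀ (a b : ZMod 2) (x y z : r × p), x ∈ (R.prod P).part a →
        y ∈ (R.prod P).part b → J a b x y z = 0 → J b a y x z = 0 := by
      intro a b x y z hx hy h0
      have : J b a y x z = -(sgn a b • J a b x y z) := by
        simp only [J]
        rw [h.skew b a y x hy hx, sgn_comm b a]
        simp only [map_neg, map_smul, LinearMap.neg_apply, LinearMap.smul_apply]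
        have e2 := sgn_mul_self a b
        match_scalars <;> first | ring1 | linear_combination -e2
      rw [this, h0, smul_zero, neg_zero]
    have swap23 : ∀ (a b c : ZMod 2) (x y z : r × p), x ∈ (R.prod P).part a →
        y ∈ (R.prod P).part b → z ∈ (R.prod P).part c → J a b x y z = 0 → J a c x z y = 0 := by
      intro a b c x y z hx hy hz h0
      have : J a c x z y = -(sgn b c • J a b x y z) := by
        simp only [J]
        rw [h.skew c b z y hz hy, h.skew (a + c) b _ y (h.even _ _ _ _ hx hz) hy,
          h.skew c (a + b) z _ hz (h.even _ _ _ _ hx hy), sgn_add_left, sgn_add_right,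
          sgn_comm c b, sgn_comm c a]
        simp only [map_neg, map_smul]
        have e2 := sgn_mul_self a c
        match_scalars <;> first | ring1 | linear_combination sgn b c * e2
      rw [this, h0, smul_zero, neg_zero]
    have J_rrr : ∀ (a b : ZMod 2) (x y z : r), x ∈ R.part a → y ∈ R.part b →
        J a b (x, 0) (y, 0) (z, 0) = 0 := by
      intro a b x y z hx hy
      simp only [J, h.subalgebra]
      rw [hr.jacobi a b x y z hx hy]
      ext <;> simp
    have J_rrp : ∀ (a b : ZMod 2) (x y : r) (z : p), x ∈ R.part a → y ∈ R.part b →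
        J a b (x, 0) (y, 0) (0, z) = 0 := by
      intro a b x y z hx hy
      simp only [J, h.subalgebra, h.action]
      rw [hν.map_bracket a b x y hx hy]
      ext <;> simp
    have J_rpp0 : ∀ (a b c : ZMod 2) (x : r) (s t : p), x ∈ R.part a → s ∈ P.part b →
        t ∈ P.part c → J a b (x, 0) (0, s) (0, t) = 0 := fun a b c x s t hx hs ht => by
      rw [J_rpp a b c x s t hx hs ht, hder a b c x s t hx hs ht]; rfl
    have hJ : ∀ (a b c : ZMod 2) (x y z : r × p), x ∈ (R.prod P).part a →
        y ∈ (R.prod P).part b → z ∈ (R.prod P).part c → J a b x y z = 0 := by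
      intro a b c x y z hx hy hz
      have h000 := J_rrr a b x.1 y.1 z.1 hx.1 hy.1
      have h001 := J_rrp a b x.1 y.1 z.2 hx.1 hy.1
      have h010 := swap23 a c b _ _ _ (inl_mem hx.1) (inl_mem hz.1) (inr_mem hy.2)
        (J_rrp a c x.1 z.1 y.2 hx.1 hz.1)
      have h100 := swap12 b a _ _ _ (inl_mem hy.1) (inr_mem hx.2)
        (swap23 b c a _ _ _ (inl_mem hy.1) (inl_mem hz.1) (inr_mem hx.2)
          (J_rrp b c y.1 z.1 x.2 hy.1 hz.1))
      have h011 := J_rpp0 a b c x.1 y.2 z.2 hx.1 hy.2 hz.2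
      have h101 := swap12 b a _ _ _ (inl_mem hy.1) (inr_mem hx.2)
        (J_rpp0 b a c y.1 x.2 z.2 hy.1 hx.2 hz.2)
      have h110 := swap23 a c b _ _ _ (inr_mem hx.2) (inl_mem hz.1) (inr_mem hy.2)
        (swap12 c a _ _ _ (inl_mem hz.1) (inr_mem hx.2)
          (J_rpp0 c a b z.1 x.2 y.2 hz.1 hx.2 hy.2))
      have h111 : J a b (0, x.2) (0, y.2) (0, z.2) = 0 := by
        rw [J_ppp hder a b c x.2 y.2 z.2 hx.2 hy.2 hz.2, hppp a b c x.2 y.2 z.2 hx.2 hy.2 hz.2]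
        rfl
      have hx1 : x = (x.1, 0) + (0, x.2) := by simp
      have hy1 : y = (y.1, 0) + (0, y.2) := by simp
      have hz1 : z = (z.1, 0) + (0, z.2) := by simp
      rw [hx1, hy1, hz1]
      simp only [J, map_add, LinearMap.add_apply] at h000 h001 h010 h100 h011 h101 h110 h111 ⊢
      linear_combination (norm := module) h000 + h001 + h010 + h100 + h011 + h101 + h110 + h111
    intro a b x y z hx hy
    obtain ⟨z0, hz0, z1, hz1, rfl⟩ := (R.prod P).exists_add z
    have h0 := hJ a b 0 x y z0 hx hy hz0
    have h1 := hJ a b 1 x y z1 hx hy hz1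
    simp only [J] at h0 h1
    simp only [map_add]
    linear_combination (norm := module) h0 + h1

end IsInvariantExtension

end extension
-- The cubic element on the orthogonal sum
section cubicElement
variable {r p : Type*} [AddCommGroup r] [Module ℂ r] [AddCommGroup p] [Module ℂ p]
  {R : SuperSpace r} {P : SuperSpace p} {br : r →ₗ[ℂ] r →ₗ[ℂ] r} {Br : SuperForm R}
  {Bp : SuperForm P} {ν : r →ₗ[ℂ] Module.End ℂ p} {νs : r →ₗ[ℂ] SExterior P}

theorem extMap_zeta {V W : Type*} [AddCommGroup V] [Module ℂ V] [AddCommGroup W] [Module ℂ W]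
    (S : SuperSpace V) (T : SuperSpace W) (f : V →ₗ[ℂ] W)
    (hf : ∀ a x, x ∈ S.part a → f x ∈ T.part a) (x : V) :
    extMap S T f hf (zeta 0 x) = zeta 0 (f x) := SClifford.lift_zeta ..

theorem extInl_zeta (x : r) : extInl R P (zeta 0 x) = zeta 0 (x, 0) := extMap_zeta ..

theorem extInr_zeta (y : p) : extInr R P (zeta 0 y) = zeta 0 (0, y) := extMap_zeta ..

theorem contr_inl_extInl {a : ZMod 2} {x : r} (hx : x ∈ R.part a) (u : SExterior R) :
    contr 0 (Br.prod Bp) (x, 0) (extInl R P u) = extInl R P (contr 0 Br x u) :=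
  contr_map_zeta Br (Br.prod Bp) _ _ hx (inl_mem hx) (fun v => by simp [prod_form_apply]) u

theorem contr_inr_extInr {a : ZMod 2} {y : p} (hy : y ∈ P.part a) (u : SExterior P) :
    contr 0 (Br.prod Bp) (0, y) (extInr R P u) = extInr R P (contr 0 Bp y u) :=
  contr_map_zeta Bp (Br.prod Bp) _ _ hy (inr_mem hy) (fun v => by simp [prod_form_apply]) u

/-- By orthogonality $(x,0)$ pairs to zero with $\mathfrak p$, so the vector $y=0$ represents the
pulled-back functional. -/
theorem contr_inl_extInr {a : ZMod 2} {x : r} (hx : x ∈ R.part a) (u : SExterior P) :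
    contr 0 (Br.prod Bp) (x, 0) (extInr R P u) = 0 := by
  refine (contr_map_zeta Bp (Br.prod Bp) (b := a) (y := 0) (z := (x, 0)) _ _
    (Submodule.zero_mem _) (inl_mem hx) (fun v => by simp [prod_form_apply]) u).trans ?_
  simp

theorem contr_inr_extInl {a : ZMod 2} {y : p} (hy : y ∈ P.part a) (u : SExterior R) :
    contr 0 (Br.prod Bp) (0, y) (extInl R P u) = 0 := by
  refine (contr_map_zeta Br (Br.prod Bp) (b := a) (y := 0) (z := (0, y)) _ _
    (Submodule.zero_mem _) (inr_mem hy) (fun v => by simp [prod_form_apply]) u).trans ?_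
  simp

/-- The projection `Λ(r ⊕ p) → Λ(p)`. -/
noncomputable def extSnd (R : SuperSpace r) (P : SuperSpace p) :
    SExterior (R.prod P) →ₐ[ℂ] SExterior P :=
  extMap (R.prod P) P (LinearMap.snd ℂ r p) (fun _ _ hx => hx.2)

theorem extSnd_zeta (z : r × p) : extSnd R P (zeta 0 z) = zeta 0 z.2 := extMap_zeta ..

theorem contr_extSnd {a : ZMod 2} {y : p} (hy : y ∈ P.part a) (u : SExterior (R.prod P)) :
    extSnd R P (contr 0 (Br.prod Bp) (0, y) u) = contr 0 Bp y (extSnd R P u) :=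
  (contr_map_zeta (Br.prod Bp) Bp _ _ (inr_mem hy) hy (fun v => by simp [prod_form_apply]) u).symm

theorem extSnd_extInr (u : SExterior P) : extSnd R P (extInr R P u) = u := by
  refine clifford_ext (f := (extSnd R P).toLinearMap ∘ₗ (extInr R P).toLinearMap)
    (g := LinearMap.id) ?_ ?_ u
  · simp
  · intro a x u _ hu
    simp only [LinearMap.comp_apply, AlgHom.toLinearMap_apply, LinearMap.id_apply] at hu ⊢
    rw [map_mul, map_mul, hu, extInr_zeta, extSnd_zeta]

theorem extSnd_extInl {n : ℕ} {a : ZMod 2} {u : SExterior R} (hu : u ∈ extPart R (n + 1) a) :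
    extSnd R P (extInl R P u) = 0 := by
  refine extPart_succ_le (LinearMap.ker ((extSnd R P).toLinearMap ∘ₗ (extInl R P).toLinearMap))
    (fun b c y v _ _ _ => ?_) hu
  simp [extInl_zeta, extSnd_zeta]

theorem extSnd_phiNu {ι : Type*} [Fintype ι] (x x' : ι → r) :
    extSnd R P (phiNu R P νs x x') = 0 := by
  rw [phiNu, map_sum]
  refine Finset.sum_eq_zero fun i _ => ?_
  rw [map_mul, extInl_zeta, extSnd_zeta]
  simp

theorem phiNu_eq {ι κ : Type*} [Fintype ι] [Fintype κ] {x x' : ι → r} {e e' : κ → r}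
    (hx : IsDualSystem Br x x') (he : IsDualSystem Br e e') :
    phiNu R P νs x x' = phiNu R P νs e e' :=
  hx.sum_eq he ((LinearMap.mul ℂ (SExterior (R.prod P))).compl₁₂
    ((extInr R P).toLinearMap ∘ₗ νs) ((extInl R P).toLinearMap ∘ₗ zeta 0))

variable {κ : Type*} [Fintype κ] {d : κ → ZMod 2} {e e' : κ → r}

theorem phiNu_mem (hmem : ∀ (a : ZMod 2) (x : r), x ∈ R.part a → νs x ∈ extPart P 2 a)
    (he : IsHomogDualSystem Br d e e') :
    phiNu R P νs e e' ∈ extPart (R.prod P) 3 0 := by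
  refine Submodule.sum_mem _ fun i _ => ?_
  have := mul_zeta_mem_extPart (inl_mem (P := P) (he.mem' i))
    (extMap_mem_extPart (T := R.prod P) (LinearMap.inr ℂ r p) (fun a _ hx => inr_mem hx)
      (hmem _ _ (he.mem i)))
  rw [CharTwo.add_self_eq_zero] at this
  rw [extInl_zeta]
  exact this

/-- The sign from moving $\iota(x)$ past $\nu_*(e_i)$ cancels that of $(x,e'_i)=\pm(e'_i,x)$; the
sum of $(e'_i,x)\nu_*(e_i)$ is $\nu_*(x)$. -/
theorem contr_phiNu (hmem : ∀ (a : ZMod 2) (x : r), x ∈ R.part a → νs x ∈ extPart P 2 a)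
    (he : IsHomogDualSystem Br d e e') {a : ZMod 2} {x : r} (hx : x ∈ R.part a) :
    contr 0 (Br.prod Bp) (x, 0) (phiNu R P νs e e') = extInr R P (νs x) := by
  have h1 : ∀ i, contr 0 (Br.prod Bp) (x, 0) (extInr R P (νs (e i)) * extInl R P (zeta 0 (e' i)))
      = Br.form (e' i) x • extInr R P (νs (e i)) := fun i => by
    have h2 := theta_of_mem a (extMap_mem_extPart (T := R.prod P) (LinearMap.inr ℂ r p)
      (fun a _ hx => inr_mem hx) (hmem _ _ (he.mem i)))
    rw [contr_mul 0 _ (inl_mem hx), contr_inl_extInr hx, zero_mul, zero_add, contr_inl_extInl hx,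
      contr_zeta 0 Br hx (he.mem' i), extInr, h2, Br.supersymm _ _ _ _ hx (he.mem' i)]
    simp only [map_smul, map_one, mul_smul_comm, mul_one, smul_smul, even_two, Even.neg_pow,
      one_pow, one_mul]
    rw [mul_right_comm, sgn_mul_self, one_mul]
  rw [phiNu, map_sum]
  simp only [h1]
  exact he.sum_left_map ((extInr R P).toLinearMap ∘ₗ νs) x

/-- The bracket of `φ_r + φ_ν + φ_p` extends the bracket of `r` and the representation. -/
theorem isInvariantExtension_cubicBracket (h : IsNuStar R br Bp ν νs)
    (he : IsHomogDualSystem Br d e e')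
    {φr : SExterior R} (hφr : IsCubicElement Br br φr) {φp : SExterior P}
    (hΦ : extInl R P φr + phiNu R P νs e e' + extInr R P φp ∈ extPart (R.prod P) 3 0) :
    IsInvariantExtension br Br Bp ν (cubicBracket (Br.prod Bp)
      (extInl R P φr + phiNu R P νs e e' + extInr R P φp)) := by
  set Φ := extInl R P φr + phiNu R P νs e e' + extInr R P φp with hΦdef
  have h1 : ∀ (a : ZMod 2) (x : r), x ∈ R.part a → contr 0 (Br.prod Bp) (x, 0) Φ
      = extInl R P (contr 0 Br x φr) + extInr R P (νs x) := fun a x hx => by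
    rw [hΦdef, map_add, map_add, contr_inl_extInl hx, contr_phiNu h.mem he hx,
      contr_inl_extInr hx, add_zero]
  refine ⟨fun _ _ _ _ hx hy => cubicBracket_mem _ hΦ hx hy,
    fun _ _ _ _ hx hy => cubicBracket_skew _ hΦ hx hy, cubicBracket_invariant _ hΦ,
    fun x x' => ?_, fun x y => ?_⟩
  · suffices (cubicBracket (Br.prod Bp) Φ).compl₁₂ (LinearMap.inl ℂ r p) (LinearMap.inl ℂ r p)
        = br.compr₂ (LinearMap.inl ℂ r p) from LinearMap.congr_fun₂ this x x'
    refine super_ext R fun a x hx => super_ext R fun b x' hx' => zeta_injective (R.prod P) ?_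
    change zeta 0 (cubicBracket (Br.prod Bp) Φ (x, 0) (x', 0)) = zeta 0 (br x x', 0)
    rw [zeta_cubicBracket _ hΦ, iotaExt, h1 b x' hx', map_add, contr_inl_extInl hx,
      contr_inl_extInr hx, add_zero, ← map_smul, ← extInl_zeta, hφr.2]
    rfl
  · suffices (cubicBracket (Br.prod Bp) Φ).compl₁₂ (LinearMap.inl ℂ r p) (LinearMap.inr ℂ r p)
        = ν.compr₂ (LinearMap.inr ℂ r p) from LinearMap.congr_fun₂ this x y
    refine super_ext R fun a x hx => super_ext P fun b y hy => zeta_injective (R.prod P) ?_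
    change zeta 0 (cubicBracket (Br.prod Bp) Φ (x, 0) (0, y)) = zeta 0 (0, ν x y)
    -- Skewness brings $x$ next to $\Phi$, where `h1` applies; then $\iota(y)$ only sees $\nu_*(x)$.
    rw [cubicBracket_skew _ hΦ (inl_mem hx) (inr_mem hy), map_neg, map_smul,
      zeta_cubicBracket _ hΦ, iotaExt, h1 a x hx, map_add, contr_inr_extInl hy,
      contr_inr_extInr hy, zero_add, h.contr_eq hx hy, map_neg, map_smul, extInr_zeta]
    have e1 := sgn_mul_self a b
    match_scalars
    linear_combination e1

/-- The projection to $\Lambda(\mathfrak p)$ commutes with contractions by $\mathfrak p$ and kills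
$\phi_{\mathfrak r}$ and $\phi_\nu$, whose terms all contain a factor from $\mathfrak r$. -/
theorem bracketSnd_cubicBracket {φr : SExterior R} (hφr : φr ∈ extPart R 3 0) {φp : SExterior P}
    (hφp : φp ∈ extPart P 3 0)
    (hΦ : extInl R P φr + phiNu R P νs e e' + extInr R P φp ∈ extPart (R.prod P) 3 0) :
    bracketSnd (cubicBracket (Br.prod Bp) (extInl R P φr + phiNu R P νs e e' + extInr R P φp))
      = cubicBracket Bp φp := by
  refine super_ext P fun a x hx => super_ext P fun b y hy => zeta_injective P ?_
  change zeta 0 (cubicBracket (Br.prod Bp) _ (0, x) (0, y)).2 = _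
  rw [← extSnd_zeta (R := R), zeta_cubicBracket _ hΦ, zeta_cubicBracket _ hφp, map_smul, iotaExt,
    contr_extSnd hx, contr_extSnd hy, map_add, map_add (extSnd R P), extSnd_extInl hφr, extSnd_phiNu,
    extSnd_extInr, zero_add, zero_add]
  rfl

theorem prod_nondegenerate (hBr : Br.form.Nondegenerate) (hBp : Bp.form.Nondegenerate) :
    (Br.prod Bp).form.Nondegenerate := by
  refine ⟨fun z hz => Prod.ext (hBr.1 _ fun x => ?_) (hBp.1 _ fun y => ?_),
    fun z hz => Prod.ext (hBr.2 _ fun x => ?_) (hBp.2 _ fun y => ?_)⟩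
  · simpa [prod_form_apply] using hz (x, 0)
  · simpa [prod_form_apply] using hz (0, y)
  · simpa [prod_form_apply] using hz (x, 0)
  · simpa [prod_form_apply] using hz (0, y)

end cubicElement

/-! ### Brackets of Lie super type and the constancy set -/

section typeBracket
variable {r p : Type*} [AddCommGroup r] [Module ℂ r] [AddCommGroup p] [Module ℂ p]
  {R : SuperSpace r} {P : SuperSpace p} {br : r →ₗ[ℂ] r →ₗ[ℂ] r} {Br : SuperForm R}
  {Bp : SuperForm P} {ν : r →ₗ[ℂ] Module.End ℂ p} {νs : r →ₗ[ℂ] SExterior P}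
  {bg : (r × p) →ₗ[ℂ] (r × p) →ₗ[ℂ] (r × p)}

theorem IsLieSuperTypeBracket.isInvariantExtension (h : IsLieSuperTypeBracket br Br Bp ν bg) :
    IsInvariantExtension br Br Bp ν bg :=
  ⟨h.quadratic.even, h.quadratic.skew, h.quadratic.invariant, h.subalgebra, h.action⟩

/-- An invariant extension whose `p`-component comes from `φp` is a bracket of Lie super type if
and only if `φp` belongs to the constancy set. -/
theorem IsInvariantExtension.isLieSuperTypeBracket_iff [FiniteDimensional ℂ r]
    [FiniteDimensional ℂ p] (hr : IsQuadraticLieSuper Br br) (hBp : Bp.form.Nondegenerate)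
    (hν : IsOspRep R br Bp ν) (hs : IsNuStar R br Bp ν νs) {ι : Type*} [Fintype ι] {x x' : ι → r}
    (hx : IsDualSystem Br x x') (h : IsInvariantExtension br Br Bp ν bg) {φp : SExterior P}
    (hφp : φp ∈ extPart P 3 0) (hK : bracketSnd bg = cubicBracket Bp φp) :
    IsLieSuperTypeBracket br Br Bp ν bg ↔ φp ∈ constancySet hs x x' := by
  have h1 := h.jacobi_iff hr.toIsLieSuper hr.invariant hν hr.nondegenerate
  rw [hK, ← hs.invariant_iff hBp hν hφp, ← constancy_iff hs hν hr.nondegenerate hBp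
    h.bracketFst_mem h.form_bracketFst hx hφp] at h1
  constructor
  · intro h2
    exact ⟨hφp, h1.1 h2.quadratic.jacobi⟩
  · rintro ⟨-, h2⟩
    exact ⟨⟨⟨h.even, h.skew, h1.2 h2⟩, prod_nondegenerate hr.nondegenerate hBp, h.invariant⟩,
      h.subalgebra, h.action⟩

end typeBracket
end SuperKostant

/-! ### The main theorem -/

open SuperKostant in
theorem theorem4p1 {r p : Type*} [AddCommGroup r] [Module ℂ r] [FiniteDimensional ℂ r]
    [AddCommGroup p] [Module ℂ p] [FiniteDimensional ℂ p]
    (R : SuperSpace r) (P : SuperSpace p)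
    (Br : SuperForm R) (br : r →ₗ[ℂ] r →ₗ[ℂ] r) (hr : IsQuadraticLieSuper Br br)
    (Bp : SuperForm P) (hBp : Bp.form.Nondegenerate)
    (ν : r →ₗ[ℂ] Module.End ℂ p) (hν : IsOspRep R br Bp ν)
    {ι : Type*} [Fintype ι] [DecidableEq ι] (x : Module.Basis ι ℂ r) (x' : ι → r)
    (hdual : ∀ i j, Br.form (x' i) (x j) = if i = j then 1 else 0) :
    (∃! φr : SExterior R, IsCubicElement Br br φr) ∧
    (∃! νs : r →ₗ[ℂ] SExterior P, IsNuStar R br Bp ν νs) ∧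
    ∀ (φr : SExterior R), IsCubicElement Br br φr →
    ∀ (νs : r →ₗ[ℂ] SExterior P) (hνs : IsNuStar R br Bp ν νs),
      (∀ φp ∈ constancySet hνs x x',
        extInl R P φr + phiNu R P νs x x' + extInr R P φp ∈ extPart (R.prod P) 3 0) ∧
      Set.BijOn
        (fun φp : SExterior P => cubicBracket (Br.prod Bp)
          (extInl R P φr + phiNu R P νs x x' + extInr R P φp))
        (constancySet hνs x x')
        {bg | IsLieSuperTypeBracket br Br Bp ν bg} ∧
      (IsOfLieSuperType br Br Bp ν ↔ (constancySet hνs x x').Nonempty) := by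
  have hBr := hr.nondegenerate
  have hx := isDualSystem_of_basis Br hBr x x' hdual
  obtain ⟨n, d, e, e', he⟩ := exists_homogDualSystem Br hBr
  refine ⟨?_, ?_, ?_⟩
  · obtain ⟨φ, hφ⟩ := exists_cubic hBr br hr.even hr.skew fun _ _ _ x y z _ _ _ =>
      hr.invariant x y z
    exact ⟨φ, hφ, fun φ' hφ' => hφ'.unique hBr hφ⟩
  · obtain ⟨νs, hνs⟩ := exists_isNuStar hr.even hBp hν
    exact ⟨νs, hνs, fun νs' hνs' => hνs'.unique hBp hνs⟩
  intro φr hφr νs hνs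
  -- The element $\phi_\nu$ does not depend on the dual bases, so a homogeneous system may be used.
  rw [phiNu_eq hx he.toIsDualSystem]
  have hmem : ∀ φp ∈ extPart P 3 0,
      extInl R P φr + phiNu R P νs e e' + extInr R P φp ∈ extPart (R.prod P) 3 0 := fun φp hφp =>
    Submodule.add_mem _ (Submodule.add_mem _ (extMap_mem_extPart _ _ hφr.1)
      (phiNu_mem hνs.mem he)) (extMap_mem_extPart _ _ hφp)
  have hext := fun φp hφp => isInvariantExtension_cubicBracket hνs he hφr (hmem φp hφp)
  have hsnd := fun φp hφp => bracketSnd_cubicBracket (Br := Br) (Bp := Bp) hφr.1 hφp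
    (hmem φp hφp)
  have hbij : Set.BijOn (fun φp : SExterior P => cubicBracket (Br.prod Bp)
      (extInl R P φr + phiNu R P νs e e' + extInr R P φp)) (constancySet hνs x x')
      {bg | IsLieSuperTypeBracket br Br Bp ν bg} := by
    refine ⟨fun φp hφp => ?_, fun φp hφp φp' hφp' heq => ?_, fun bg hbg => ?_⟩
    · exact ((hext φp hφp.1).isLieSuperTypeBracket_iff hr hBp hν hνs hx hφp.1
        (hsnd φp hφp.1)).2 hφp
    · have h1 : cubicBracket Bp φp = cubicBracket Bp φp' := by
        rw [← hsnd φp hφp.1, ← hsnd φp' hφp'.1]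
        exact congrArg bracketSnd heq
      refine IsCubicElement.unique hBp (K := cubicBracket Bp φp)
        ⟨hφp.1, zeta_cubicBracket Bp hφp.1⟩ ⟨hφp'.1, ?_⟩
      rw [h1]
      exact zeta_cubicBracket Bp hφp'.1
    · have hbg' := IsLieSuperTypeBracket.isInvariantExtension hbg
      -- Surjectivity: integrate the $\mathfrak p$-component of the given bracket; two invariant
      -- extensions with the same $\mathfrak p$-component coincide.
      obtain ⟨φp, hφp⟩ := exists_cubic hBp (bracketSnd bg) hbg'.bracketSnd_mem
        hbg'.bracketSnd_skew fun _ _ _ x y z _ _ _ => hbg'.bracketSnd_invariant x y z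
      refine ⟨φp, (hbg'.isLieSuperTypeBracket_iff hr hBp hν hνs hx hφp.1
        hφp.cubicBracket_eq.symm).1 hbg, ?_⟩
      exact (hext φp hφp.1).ext hBr hbg' ((hsnd φp hφp.1).trans hφp.cubicBracket_eq)
  refine ⟨fun φp hφp => hmem φp hφp.1, hbij, ?_⟩
  constructor
  · rintro ⟨bg, hbg⟩
    obtain ⟨φp, hφp, -⟩ := hbij.surjOn hbg
    exact ⟨φp, hφp⟩
  · rintro ⟨φp, hφp⟩
    exact ⟨_, hbij.mapsTo hφp⟩
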